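/- Let $M\subset\mathbb{R}^D$ be a smooth ($C^\infty$) $d$-dimensional embedded submanifold, with the Riemannian metric induced from $\mathbb{R}^D$, and write $\mathrm{d}x'$ for its Riemannian measure. Let $p:M\to[0,\infty)$ be a probability density with respect to this measure, and let $x\in M$ be a point at which $p$ is continuous and $p(x)>0$. For $\delta\in\mathbb{R}$ let $B(x,e^\delta)$ be the open Euclidean ball in $\mathbb{R}^D$, let $$\varrho_{\mathcal U}(x,\delta)=\int_M p(x')\,\mathcal{U}_D(x-x';0,\delta)\,\mathrm{d}x',\qquad \mathcal{U}_D(z;0,\delta)=\pi^{-D/2}\,\Gamma\!\left(\tfrac D2+1\right)e^{-D\delta}\,\mathbf{1}(\|z\|<e^\delta),$$ be the convolution of $p$ with the uniform distribution on the ball of log radius $\delta$, and let $X$ be a random point of $M$ with density $p$. Then, for all $\delta\in\mathbb{R}$, $$\varrho_{\mathcal U}(x,\delta)=\pi^{-D/2}\,\Gamma\!\left(\tfrac D2+1\right)e^{-D\delta}\,\mathbb{P}(X\in B(x,e^\delta))>0,$$ and $$\lim_{\delta\to-\infty}\frac{\partial}{\partial\delta}\log\varrho_{\mathcal U}(x,\delta)=d-D,\qquad\text{equivalently}\qquad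 \lim_{\delta\to-\infty}\frac{\partial}{\partial\delta}\log\mathbb{P}(X\in B(x,e^\delta))=d,$$ where $d=\mathrm{LID}(x)$ is the dimension of $M$. The limits are understood as follows. Let $f(\delta)$ be $\log\varrho_{\mathcal U}(x,\delta)$ or $\log\mathbb{P}(X\in B(x,e^\delta))$, and let $\ell=d-D$ or $\ell=d$ respectively. 1. $f$ is differentiable at almost every $\delta\in\mathbb{R}$, and $f'(\delta)\to\ell$ as $\delta\to-\infty$ through the points at which $f$ is differentiable. Moreover, for every $\varepsilon>0$ and every sufficiently negative $\delta$ (whether or not $f$ is differentiable at $\delta$), $\left|\frac{f(\delta+h)-f(\delta)}{h}-\ell\right|<\varepsilon$ for all sufficiently small $h\neq0$. 2. If $p$ is continuous in a neighbourhood of $x$ in $M$, then $f$ is differentiable at every sufficiently negative $\delta$, and $f'(\delta)\to\ell$ as $\delta\to-\infty$. -/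

import Mathlib

open MeasureTheory Filter Topology
open scoped Manifold ContDiff

noncomputable section

/-- The volume factor `√det g` of a parametrization `φ : ℝᵈ → ℝᴰ` at `y`, where
`g i j = ⟪∂ᵢ φ (y), ∂ⱼ φ (y)⟫` is the matrix of the metric induced from `ℝᴰ` in the coordinates
given by `φ`. -/
def sqrtDetMetric {d D : ℕ} (φ : EuclideanSpace ℝ (Fin d) → EuclideanSpace ℝ (Fin D))
    (y : EuclideanSpace ℝ (Fin d)) : ℝ :=
  √(Matrix.gram ℝ fun i : Fin d => fderiv ℝ φ y (EuclideanSpace.single i 1)).det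

/-- The Riemannian measure carried by the domain of one chart `c` of `M`, for the metric induced on
`M` by `ι : M → ℝᴰ`: the image under `c⁻¹` of the measure `√det g(y) dy` on the target of `c`. -/
def chartRiemannianMeasure {d D : ℕ} {M : Type*} [TopologicalSpace M] [MeasurableSpace M]
    (ι : M → EuclideanSpace ℝ (Fin D)) (c : OpenPartialHomeomorph M (EuclideanSpace ℝ (Fin d))) :
    Measure M :=
  ((volume.restrict c.target).withDensity fun y =>
    ENNReal.ofReal (sqrtDetMetric (fun z => ι (c.symm z)) y)).map c.symm

/-- The Riemannian measure of a `d`-dimensional manifold `M` with the metric induced by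
`ι : M → ℝᴰ`. It is the smallest measure that dominates `√det g(y) dy` in every smooth chart.
(The measures coming from two charts agree on the overlap of the charts, so this is the measure
which in every chart is given by `√det g(y) dy`.) -/
def riemannianMeasure (d : ℕ) {D : ℕ} {M : Type*} [TopologicalSpace M] [MeasurableSpace M]
    [ChartedSpace (EuclideanSpace ℝ (Fin d)) M] (ι : M → EuclideanSpace ℝ (Fin D)) : Measure M :=
  ⨆ c ∈ IsManifold.maximalAtlas (𝓡 d) ∞ M, chartRiemannianMeasure ι c

/-- `p` is a probability density function with respect to `ν`. -/
structure IsProbabilityDensity {M : Type*} [MeasurableSpace M] (ν : Measure M) (p : M → ℝ) :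
    Prop where
  nonneg : ∀ y, 0 ≤ p y
  integrable : Integrable p ν
  integral_eq_one : ∫ y, p y ∂ν = 1

/-- The density at `x ∈ ℝᴰ` of the uniform distribution on the open ball with centre `μ` and
log radius `δ`. -/
def uniformDensity {D : ℕ} (x μ : EuclideanSpace ℝ (Fin D)) (δ : ℝ) : ℝ :=
  Real.pi ^ (-(D : ℝ) / 2) * Real.Gamma ((D : ℝ) / 2 + 1) * Real.exp (-(D : ℝ) * δ) *
    (Metric.ball μ (Real.exp δ)).indicator (fun _ => (1 : ℝ)) x

/-- The convolution `∫_M p(x') U(x - x'; 0, δ) dx'` of the density `p` on the submanifold `M` with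
the uniform distribution on the ball of log radius `δ`, where `dx'` is the Riemannian measure. -/
def uniformConvolution (d : ℕ) {D : ℕ} (M : Set (EuclideanSpace ℝ (Fin D)))
    [ChartedSpace (EuclideanSpace ℝ (Fin d)) M] (p : M → ℝ) (x : EuclideanSpace ℝ (Fin D))
    (δ : ℝ) : ℝ :=
  ∫ x' : M, p x' * uniformDensity (x - (x' : EuclideanSpace ℝ (Fin D))) 0 δ
    ∂(riemannianMeasure d ((↑) : M → EuclideanSpace ℝ (Fin D)))

/-- The law on `ℝᴰ` of a random point of the submanifold `M` with density `p` with respect to the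
Riemannian measure of `M`. -/
def densityLaw (d : ℕ) {D : ℕ} (M : Set (EuclideanSpace ℝ (Fin D)))
    [ChartedSpace (EuclideanSpace ℝ (Fin d)) M] (p : M → ℝ) :
    Measure (EuclideanSpace ℝ (Fin D)) :=
  ((riemannianMeasure d ((↑) : M → EuclideanSpace ℝ (Fin D))).withDensity fun y =>
    ENNReal.ofReal (p y)).map (↑)

/-- The logarithm of the probability that a random point with density `p` on `M` lies in the open
ball with centre `x` and log radius `δ`. -/
def logBallProbability (d : ℕ) {D : ℕ} (M : Set (EuclideanSpace ℝ (Fin D)))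
    [ChartedSpace (EuclideanSpace ℝ (Fin d)) M] (p : M → ℝ) (x : EuclideanSpace ℝ (Fin D))
    (δ : ℝ) : ℝ :=
  Real.log ((densityLaw d M p).real (Metric.ball x (Real.exp δ)))

/-- The logarithm of the convolution of `p` with the uniform distribution on the ball of log
radius `δ`, at the point `x`. -/
def logUniformConvolution (d : ℕ) {D : ℕ} (M : Set (EuclideanSpace ℝ (Fin D)))
    [ChartedSpace (EuclideanSpace ℝ (Fin d)) M] (p : M → ℝ) (x : EuclideanSpace ℝ (Fin D))
    (δ : ℝ) : ℝ :=
  Real.log (uniformConvolution d M p x δ)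

/-- `∂_δ f(δ)` exists for almost every `δ ∈ ℝ` (so for arbitrarily negative ones), and it tends
to `l` as `δ → -∞` through the points where it exists. The points where it may fail to exist are
covered as well: at every sufficiently negative `δ` all limit points of the difference quotients
of `f` are within `ε` of `l`. -/
def AeDerivTendstoAtBot (f : ℝ → ℝ) (l : ℝ) : Prop :=
  (∀ᵐ δ : ℝ, DifferentiableAt ℝ f δ) ∧
    Tendsto (deriv f) (atBot ⊓ 𝓟 {δ | DifferentiableAt ℝ f δ}) (𝓝 l) ∧
    ∀ ε > 0, ∀ᶠ δ in atBot, ∀ᶠ h in 𝓝[≠] (0 : ℝ), |(f (δ + h) - f δ) / h - l| < ε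

/-- `∂_δ f(δ)` exists for every sufficiently negative `δ`, and it tends to `l` as `δ → -∞`. -/
def DerivTendstoAtBot (f : ℝ → ℝ) (l : ℝ) : Prop :=
  (∀ᶠ δ in atBot, DifferentiableAt ℝ f δ) ∧ Tendsto (deriv f) atBot (𝓝 l)

end

/-! The derivative of the logarithm depends on the mass of thin shells around `x`, so the
asymptotics `P(B(x, r)) ~ C r ^ d` alone would not suffice. The proof therefore looks for
coordinates in which Euclidean balls of the ambient space become round balls exactly. Let `φ`
parametrize `M` near `x`, with `F = φ - x` vanishing at the base point and with injective derivative
there. After a linear change of variables this derivative is an isometry, and `u ↦ (‖F u‖ / ‖u‖) •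
u` is a `C¹` map whose derivative at the origin is the identity. By the inverse function theorem it
gives coordinates in which `‖F ·‖` is the distance to the origin (`exists_radialCoordinates`).

In a chart the Riemannian measure is `√det g(y) dy`, because chart measures agree on overlaps.
Passing to radial coordinates, the mass of every small ball is the integral over the ball of the
same radius in `ℝᵈ` of a density `w` that is continuous and positive at the origin
(`exists_density_on_model`). Hence the mass of a small shell is `w 0 ± ε` times its volume, and this
volume is a constant times an increment of `exp (d * δ)`. Together with the corresponding bounds on
the mass of balls, this squeezes the difference quotients of the logarithm to `d`
(`eventually_abs_log_quotient_sub_lt`).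

Differentiability almost everywhere comes from monotonicity in the radius. If `p` is continuous near
`x`, so is `w` near the origin, and polar coordinates with the fundamental theorem of calculus give
differentiability for all very negative `δ`. The logarithm of the convolution differs from that of
the ball probability by an affine function of slope `-D`. -/

/-! ### Difference quotients of logarithms -/

lemma Real.log_sub_log_le_sub_div {a b : ℝ} (ha : 0 < a) (hb : 0 < b) :
    Real.log b - Real.log a ≤ (b - a) / a := by
  rw [← Real.log_div hb.ne' ha.ne']
  have := Real.log_le_sub_one_of_pos (div_pos hb ha)
  rwa [sub_div, div_self ha.ne']

lemma Real.sub_div_le_log_sub_log {a b : ℝ} (ha : 0 < a) (hb : 0 < b) :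
    (b - a) / b ≤ Real.log b - Real.log a := by
  have := Real.log_sub_log_le_sub_div hb ha
  have h : (a - b) / b = -((b - a) / b) := by ring
  linarith

lemma tendsto_exp_mul_sub_one_div (d : ℝ) :
    Tendsto (fun t : ℝ => (Real.exp (d * t) - 1) / t) (𝓝[≠] 0) (𝓝 d) := by
  have h : HasDerivAt (fun t : ℝ => Real.exp (d * t)) d 0 := by
    simpa using ((hasDerivAt_id (0 : ℝ)).const_mul d).exp
  have := hasDerivAt_iff_tendsto_slope_zero.1 h
  refine this.congr fun t => ?_
  simp [div_eq_inv_mul]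

/-- Two-sided bounds on the values and on the increments of a positive function `F` by those of
`C * exp (d * ·)` control the difference quotients of `log F`. -/
lemma eventually_abs_log_quotient_sub_lt {F : ℝ → ℝ} (hF : ∀ δ, 0 < F δ) {C d : ℝ} (hC : 0 < C)
    (hdiff : ∀ ε > 0, ∀ᶠ δ₀ in atBot, ∀ δ₁ δ₂, δ₁ ≤ δ₂ → δ₂ ≤ δ₀ →
      (C - ε) * (Real.exp (d * δ₂) - Real.exp (d * δ₁)) ≤ F δ₂ - F δ₁ ∧
      F δ₂ - F δ₁ ≤ (C + ε) * (Real.exp (d * δ₂) - Real.exp (d * δ₁)))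
    (hval : ∀ ε > 0, ∀ᶠ δ₀ in atBot, ∀ δ ≤ δ₀, (C - ε) * Real.exp (d * δ) ≤ F δ ∧
      F δ ≤ (C + ε) * Real.exp (d * δ)) (hd : 0 ≤ d) {ε : ℝ} (hε : 0 < ε) :
    ∀ᶠ δ in atBot, ∀ᶠ h in 𝓝[≠] (0 : ℝ),
      |(Real.log (F (δ + h)) - Real.log (F δ)) / h - d| < ε := by
  -- Both ratios tend to `1` as `η` tends to `0`, so a small `η` absorbs the relative error into
  -- `ε`.
  obtain ⟨η, hη0, hηC, hK1, hK2⟩ : ∃ η, 0 < η ∧ η < C ∧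
      (C + η) / (C - η) * d < d + ε ∧ d - ε < (C - η) / (C + η) * d := by
    have h1 : Tendsto (fun η : ℝ => (C + η) / (C - η) * d) (𝓝 0) (𝓝 ((C + 0) / (C - 0) * d)) :=
      (((tendsto_const_nhds.add tendsto_id).div (tendsto_const_nhds.sub tendsto_id)
        (by simpa using hC.ne')).mul_const d)
    have h2 : Tendsto (fun η : ℝ => (C - η) / (C + η) * d) (𝓝 0) (𝓝 ((C - 0) / (C + 0) * d)) :=
      (((tendsto_const_nhds.sub tendsto_id).div (tendsto_const_nhds.add tendsto_id)
        (by simpa using hC.ne')).mul_const d)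
    simp only [add_zero, sub_zero, div_self hC.ne', one_mul] at h1 h2
    have e1 := (h1.eventually (gt_mem_nhds (by linarith : d < d + ε))).filter_mono
      (nhdsWithin_le_nhds (s := Set.Ioi 0))
    have e2 := (h2.eventually (lt_mem_nhds (by linarith : d - ε < d))).filter_mono
      (nhdsWithin_le_nhds (s := Set.Ioi 0))
    have e3 : ∀ᶠ η : ℝ in 𝓝[>] 0, 0 < η := self_mem_nhdsWithin
    have e4 : ∀ᶠ η : ℝ in 𝓝[>] 0, η < C := (gt_mem_nhds hC).filter_mono nhdsWithin_le_nhds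
    obtain ⟨η, h1, h2, h3, h4⟩ := (e1.and (e2.and (e3.and e4))).exists
    exact ⟨η, h3, h4, h1, h2⟩
  have hlow : ∀ᶠ h in 𝓝[≠] (0 : ℝ),
      d - ε < (C - η) / (C + η) * (-((Real.exp (-d * |h|) - 1) / |h|)) := by
    have := ((tendsto_exp_mul_sub_one_div (-d)).comp
      (tendsto_abs_nhdsNE_zero.mono_right (nhdsWithin_mono _ fun _ h => ne_of_gt h))).neg.const_mul
      ((C - η) / (C + η))
    rw [neg_neg] at this
    exact this.eventually (lt_mem_nhds hK2)
  have hup : ∀ᶠ h in 𝓝[≠] (0 : ℝ),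
      (C + η) / (C - η) * ((Real.exp (d * |h|) - 1) / |h|) < d + ε := by
    have := ((tendsto_exp_mul_sub_one_div d).comp
      (tendsto_abs_nhdsNE_zero.mono_right (nhdsWithin_mono _ fun _ h => ne_of_gt h))).const_mul
      ((C + η) / (C - η))
    exact this.eventually (gt_mem_nhds hK1)
  obtain ⟨δ₀, hδd, hδv⟩ := ((hdiff η hη0).and (hval η hη0)).exists
  -- The elementary bounds `1 - a / b ≤ log b - log a ≤ b / a - 1` are used. In each ratio of
  -- constants the numerator comes from the increment bound and the denominator from the value
  -- bound.
  have key : ∀ δ₁ δ₂, δ₁ < δ₂ → δ₂ ≤ δ₀ →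
      (C - η) / (C + η) * (-(Real.exp (-d * (δ₂ - δ₁)) - 1)) ≤
        Real.log (F δ₂) - Real.log (F δ₁) ∧ Real.log (F δ₂) - Real.log (F δ₁) ≤
        (C + η) / (C - η) * (Real.exp (d * (δ₂ - δ₁)) - 1) := by
    intro δ₁ δ₂ h12 h2
    obtain ⟨hl, hu⟩ := hδd δ₁ δ₂ h12.le h2
    have hCη : 0 < C - η := by linarith
    have hCη' : 0 < C + η := by linarith
    have hV : 0 ≤ Real.exp (d * δ₂) - Real.exp (d * δ₁) :=
      sub_nonneg.2 (Real.exp_le_exp.2 (mul_le_mul_of_nonneg_left h12.le hd))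
    constructor
    · refine le_trans ?_ (Real.sub_div_le_log_sub_log (hF δ₁) (hF δ₂))
      calc (C - η) / (C + η) * (-(Real.exp (-d * (δ₂ - δ₁)) - 1))
          = ((C - η) * (Real.exp (d * δ₂) - Real.exp (d * δ₁))) /
              ((C + η) * Real.exp (d * δ₂)) := by
            rw [show -d * (δ₂ - δ₁) = d * δ₁ - d * δ₂ by ring, Real.exp_sub]
            field_simp
            ring
        _ ≤ (F δ₂ - F δ₁) / ((C + η) * Real.exp (d * δ₂)) := by gcongr
        _ ≤ (F δ₂ - F δ₁) / F δ₂ := by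
            have : 0 ≤ F δ₂ - F δ₁ := (mul_nonneg hCη.le hV).trans hl
            exact div_le_div_of_nonneg_left this (hF δ₂) (hδv δ₂ h2).2
    · refine (Real.log_sub_log_le_sub_div (hF δ₁) (hF δ₂)).trans ?_
      calc (F δ₂ - F δ₁) / F δ₁
          ≤ ((C + η) * (Real.exp (d * δ₂) - Real.exp (d * δ₁))) / F δ₁ := by
            gcongr
            exact (hF δ₁).le
        _ ≤ ((C + η) * (Real.exp (d * δ₂) - Real.exp (d * δ₁))) /
              ((C - η) * Real.exp (d * δ₁)) := by
            refine div_le_div_of_nonneg_left (mul_nonneg hCη'.le hV) (by positivity)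
              (hδv δ₁ (h12.le.trans h2)).1
        _ = (C + η) / (C - η) * (Real.exp (d * (δ₂ - δ₁)) - 1) := by
            rw [show d * (δ₂ - δ₁) = d * δ₂ - d * δ₁ by ring, Real.exp_sub]
            field_simp
  -- The strict inequality leaves room for `δ + h ≤ δ₀` when `h > 0`.
  filter_upwards [eventually_lt_atBot δ₀] with δ hδ
  have hsmall : ∀ᶠ h in 𝓝[≠] (0 : ℝ), |h| < δ₀ - δ := by
    have : Tendsto (fun t : ℝ => |t|) (𝓝 0) (𝓝 |0|) := continuous_abs.tendsto 0
    rw [abs_zero] at this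
    exact (this.mono_left nhdsWithin_le_nhds).eventually (gt_mem_nhds (by linarith))
  filter_upwards [hlow, hup, hsmall, self_mem_nhdsWithin] with h hl hu hs hne
  have main : (C - η) / (C + η) * (-((Real.exp (-d * |h|) - 1) / |h|)) ≤
        (Real.log (F (δ + h)) - Real.log (F δ)) / h ∧
        (Real.log (F (δ + h)) - Real.log (F δ)) / h ≤
        (C + η) / (C - η) * ((Real.exp (d * |h|) - 1) / |h|) := by
    rcases lt_or_gt_of_ne hne with h0 | h0
    · rw [abs_of_neg h0] at hs ⊢
      obtain ⟨k1, k2⟩ := key (δ + h) δ (by linarith) hδ.le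
      rw [show δ - (δ + h) = -h by ring] at k1 k2
      have hh : 0 < -h := by linarith
      rw [show (Real.log (F (δ + h)) - Real.log (F δ)) / h =
        (Real.log (F δ) - Real.log (F (δ + h))) / -h by rw [div_neg, ← neg_div, neg_sub],
        ← neg_div, ← mul_div_assoc, ← mul_div_assoc]
      exact ⟨div_le_div_of_nonneg_right k1 hh.le, div_le_div_of_nonneg_right k2 hh.le⟩
    · rw [abs_of_pos h0] at hs ⊢
      obtain ⟨k1, k2⟩ := key δ (δ + h) (by linarith) (by linarith)
      rw [show δ + h - δ = h by ring] at k1 k2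
      rw [← neg_div, ← mul_div_assoc, ← mul_div_assoc]
      exact ⟨div_le_div_of_nonneg_right k1 h0.le, div_le_div_of_nonneg_right k2 h0.le⟩
  rw [abs_lt]
  constructor <;> linarith [main.1, main.2]

/-- The limit of the derivatives follows from the control of the difference quotients. -/
lemma aeDerivTendstoAtBot_of_quotient {f : ℝ → ℝ} {l : ℝ}
    (hdiff : ∀ᵐ δ : ℝ, DifferentiableAt ℝ f δ)
    (hq : ∀ ε > 0, ∀ᶠ δ in atBot, ∀ᶠ h in 𝓝[≠] (0 : ℝ), |(f (δ + h) - f δ) / h - l| < ε) :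
    AeDerivTendstoAtBot f l := by
  refine ⟨hdiff, ?_, hq⟩
  rw [Metric.tendsto_nhds]
  intro ε hε
  rw [eventually_inf_principal]
  filter_upwards [hq (ε / 2) (half_pos hε)] with δ hδ hdδ
  have h1 := hasDerivAt_iff_tendsto_slope_zero.1 hdδ.hasDerivAt
  have h2 : Tendsto (fun h => |(f (δ + h) - f δ) / h - l|) (𝓝[≠] 0) (𝓝 |deriv f δ - l|) := by
    refine ((h1.sub_const l).abs).congr fun t => ?_
    simp [div_eq_inv_mul]
  have := le_of_tendsto h2 (hδ.mono fun _ h => h.le)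
  rw [Real.dist_eq]
  linarith

lemma AeDerivTendstoAtBot.affine_add {f : ℝ → ℝ} {l : ℝ} (hf : AeDerivTendstoAtBot f l)
    (a b : ℝ) : AeDerivTendstoAtBot (fun δ => a + b * δ + f δ) (l + b) := by
  refine aeDerivTendstoAtBot_of_quotient ?_ ?_
  · filter_upwards [hf.1] with δ hδ
    fun_prop
  · intro ε hε
    filter_upwards [hf.2.2 ε hε] with δ hδ
    filter_upwards [hδ, self_mem_nhdsWithin] with h hh hne
    have hne' : h ≠ 0 := hne
    convert hh using 2
    field_simp
    ring

lemma AeDerivTendstoAtBot.derivTendstoAtBot {f : ℝ → ℝ} {l : ℝ} (hf : AeDerivTendstoAtBot f l)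
    (hd : ∀ᶠ δ in atBot, DifferentiableAt ℝ f δ) : DerivTendstoAtBot f l := by
  refine ⟨hd, ?_⟩
  have := hf.2.1
  rwa [inf_eq_left.2 (le_principal_iff.2 hd)] at this

/-- The logarithm inherits monotonicity from `F`, so Lebesgue's theorem differentiates it almost
everywhere without any regularity of `F`. -/
lemma aeDerivTendstoAtBot_log {F : ℝ → ℝ} (hmono : Monotone F) (hF : ∀ δ, 0 < F δ) {C d : ℝ}
    (hC : 0 < C) (hd : 0 ≤ d)
    (hdiff : ∀ ε > 0, ∀ᶠ δ₀ in atBot, ∀ δ₁ δ₂, δ₁ ≤ δ₂ → δ₂ ≤ δ₀ →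
      (C - ε) * (Real.exp (d * δ₂) - Real.exp (d * δ₁)) ≤ F δ₂ - F δ₁ ∧
      F δ₂ - F δ₁ ≤ (C + ε) * (Real.exp (d * δ₂) - Real.exp (d * δ₁)))
    (hval : ∀ ε > 0, ∀ᶠ δ₀ in atBot, ∀ δ ≤ δ₀, (C - ε) * Real.exp (d * δ) ≤ F δ ∧
      F δ ≤ (C + ε) * Real.exp (d * δ)) :
    AeDerivTendstoAtBot (fun δ => Real.log (F δ)) d := by
  refine aeDerivTendstoAtBot_of_quotient ?_
    fun ε hε => eventually_abs_log_quotient_sub_lt hF hC hdiff hval hd hε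
  have : Monotone fun δ => Real.log (F δ) := fun a b hab => Real.log_le_log (hF a) (hmono hab)
  exact this.ae_differentiableAt

/-! ### Polar coordinates and differentiation in the radius -/

section Polar

variable {E : Type*} [NormedAddCommGroup E] [InnerProductSpace ℝ E] [FiniteDimensional ℝ E]
  [MeasurableSpace E] [BorelSpace E]

/-- Polar coordinates for the integral of a continuous function over a ball. -/
lemma setIntegral_ball_eq_intervalIntegral [Nontrivial E] (μ : Measure E) [μ.IsAddHaarMeasure]
    {w : E → ℝ} (hw : Continuous w) {r : ℝ} (hr : 0 ≤ r) :
    ∫ z in Metric.ball 0 r, w z ∂μ =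
      ∫ s in (0)..r, s ^ (Module.finrank ℝ E - 1) *
        ∫ θ, w (s • (θ : E)) ∂μ.toSphere := by
  set n := Module.finrank ℝ E - 1 with hn
  set g : E → ℝ := (Metric.ball 0 r).indicator w with hg
  have hgi : Integrable g μ := by
    rw [hg, integrable_indicator_iff measurableSet_ball]
    exact (hw.continuousOn.integrableOn_compact (isCompact_closedBall (0 : E) r)).mono_set
      Metric.ball_subset_closedBall
  -- Away from the origin, which is a null set, `μ` is the product of the sphere measure and `s ^ n
  -- ds`.
  have hmp := μ.measurePreserving_homeomorphUnitSphereProd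
  have hemb := (homeomorphUnitSphereProd E).measurableEmbedding
  set G : Metric.sphere (0 : E) 1 × Set.Ioi (0 : ℝ) → ℝ := fun q => g (q.2.1 • q.1.1) with hG
  have hcomp : ∀ y : ({0}ᶜ : Set E), G (homeomorphUnitSphereProd E y) = g y := by
    intro y
    have hy : (y : E) ≠ 0 := y.2
    simp [hG, smul_smul, norm_ne_zero_iff.2 hy]
  have hGi : Integrable G (μ.toSphere.prod (.volumeIoiPow n)) := by
    rw [← hmp.integrable_comp_emb hemb]
    have : G ∘ homeomorphUnitSphereProd E = g ∘ Subtype.val := funext hcomp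
    rw [this, ← integrableOn_iff_comap_subtypeVal (measurableSet_singleton _).compl]
    exact hgi.integrableOn
  calc ∫ z in Metric.ball 0 r, w z ∂μ
      = ∫ z, g z ∂μ := (integral_indicator measurableSet_ball).symm
    _ = ∫ y : ({0}ᶜ : Set E), g y ∂(μ.comap (↑)) := by
      rw [integral_subtype_comap (measurableSet_singleton _).compl g,
        restrict_compl_singleton]
    _ = ∫ y : ({0}ᶜ : Set E), G (homeomorphUnitSphereProd E y) ∂(μ.comap (↑)) := by
      simp only [hcomp]
    _ = ∫ q, G q ∂(μ.toSphere.prod (.volumeIoiPow n)) := hmp.integral_comp hemb G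
    _ = ∫ s, ∫ θ, G (θ, s) ∂μ.toSphere ∂(Measure.volumeIoiPow n) := by
      rw [integral_prod_symm _ hGi]
    _ = ∫ s : Set.Ioi (0 : ℝ), (Set.Iio r).indicator (fun s => ∫ θ, w (s • (θ : E)) ∂μ.toSphere) s
          ∂(Measure.volumeIoiPow n) := by
      refine integral_congr_ae (.of_forall fun s => ?_)
      have hs : (0 : ℝ) < s := s.2
      have hmem : ∀ θ : Metric.sphere (0 : E) 1,
          ((s : ℝ) • (θ : E)) ∈ Metric.ball (0 : E) r ↔ (s : ℝ) < r := by
        intro θ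
        simp [norm_smul, abs_of_pos hs]
      by_cases h : (s : ℝ) < r
      · simp [hG, hg, Set.indicator, norm_smul, abs_of_pos hs, h]
      · simp [hG, hg, Set.indicator, norm_smul, abs_of_pos hs, h]
    _ = ∫ s in (0)..r, s ^ n * ∫ θ, w (s • (θ : E)) ∂μ.toSphere := by
      simp only [Measure.volumeIoiPow, ENNReal.ofReal]
      rw [integral_withDensity_eq_integral_smul (by fun_prop),
        integral_subtype_comap measurableSet_Ioi fun a : ℝ ↦ Real.toNNReal (a ^ n) •
          (Set.Iio r).indicator (fun s => ∫ θ, w (s • (θ : E)) ∂μ.toSphere) a,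
        intervalIntegral.integral_of_le hr, integral_Ioc_eq_integral_Ioo,
        ← integral_indicator measurableSet_Ioi, ← integral_indicator measurableSet_Ioo]
      refine integral_congr_ae (.of_forall fun s => ?_)
      by_cases h0 : 0 < s
      · by_cases h1 : s < r
        · simp [Set.indicator, h0, h1, NNReal.smul_def, Real.coe_toNNReal _ (pow_nonneg h0.le _)]
        · simp [Set.indicator, h0, h1]
      · simp [Set.indicator, h0]

/-- The integral of a continuous function over a ball is a differentiable function of the
radius. -/
lemma differentiableAt_setIntegral_ball [Nontrivial E] (μ : Measure E) [μ.IsAddHaarMeasure]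
    {w : E → ℝ} {R : ℝ} (hw : ContinuousOn w (Metric.ball 0 R)) {r : ℝ} (hr : 0 < r)
    (hrR : r < R) :
    DifferentiableAt ℝ (fun s => ∫ z in Metric.ball 0 s, w z ∂μ) r := by
  obtain ⟨R', hrR', hR'⟩ := exists_between hrR
  have hR'0 : 0 < R' := hr.trans hrR'
  have hmax : ∀ z : E, 0 < max R' ‖z‖ := fun z => lt_max_of_lt_left hR'0
  -- `T` retracts `E` radially onto the closed ball of radius `R' < R`. Thus `w ∘ T` is continuous
  -- everywhere and equals `w` on the ball of radius `R'`, which suffices near `r`.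
  set T : E → E := fun z => (R' / max R' ‖z‖) • z with hT
  have hTc : Continuous T := by
    refine Continuous.smul (continuous_const.div (by fun_prop) fun z => (hmax z).ne')
      continuous_id
  have hTb : ∀ z, T z ∈ Metric.ball (0 : E) R := by
    intro z
    rw [mem_ball_zero_iff, hT, norm_smul, Real.norm_of_nonneg (div_pos hR'0 (hmax z)).le,
      div_mul_eq_mul_div]
    refine lt_of_le_of_lt ?_ hR'
    rw [div_le_iff₀ (hmax z)]
    exact mul_le_mul_of_nonneg_left (le_max_right _ _) hR'0.le
  have hTi : ∀ z ∈ Metric.ball (0 : E) R', T z = z := by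
    intro z hz
    rw [mem_ball_zero_iff] at hz
    simp [hT, max_eq_left hz.le, hR'0.ne']
  have hwT : Continuous (w ∘ T) := hw.comp_continuous hTc hTb
  set m : ℝ → ℝ := fun s => s ^ (Module.finrank ℝ E - 1) *
    ∫ θ, (w ∘ T) (s • (θ : E)) ∂μ.toSphere with hm
  have hmc : Continuous m := by
    refine (continuous_pow _).mul ?_
    have := continuous_parametric_integral_of_continuous (μ := μ.toSphere)
      (f := fun (s : ℝ) (θ : Metric.sphere (0 : E) 1) => (w ∘ T) (s • (θ : E)))
      (by
        refine hwT.comp ?_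
        exact continuous_fst.smul (continuous_subtype_val.comp continuous_snd))
      isCompact_univ
    simpa using this
  have hder : HasDerivAt (fun s => ∫ t in (0)..s, m t) (m r) r :=
    intervalIntegral.integral_hasDerivAt_right (hmc.intervalIntegrable _ _)
      (hmc.stronglyMeasurableAtFilter _ _) hmc.continuousAt
  refine (hder.congr_of_eventuallyEq ?_).differentiableAt
  filter_upwards [Ioo_mem_nhds hr hrR'] with s hs
  rw [← setIntegral_ball_eq_intervalIntegral μ hwT hs.1.le]
  refine setIntegral_congr_fun measurableSet_ball fun z hz => ?_
  simp [hTi z (Metric.ball_subset_ball hs.2.le hz)]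

end Polar

/-! ### Radial coordinates for an immersion -/

section Radial

variable {E G : Type*} [NormedAddCommGroup E] [InnerProductSpace ℝ E]
  [NormedAddCommGroup G]

/-- The point on the ray through `u` whose distance to the origin is `‖F u‖`. -/
noncomputable def radialMap (F : E → G) (u : E) : E := (‖F u‖ / ‖u‖) • u

lemma radialMap_zero (F : E → G) : radialMap F 0 = 0 := by simp [radialMap]

lemma norm_radialMap {F : E → G} (hF0 : F 0 = 0) (u : E) : ‖radialMap F u‖ = ‖F u‖ := by
  rcases eq_or_ne u 0 with rfl | hu
  · simp [radialMap_zero, hF0]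
  · rw [radialMap, norm_smul, Real.norm_of_nonneg (by positivity),
      div_mul_cancel₀ _ (norm_ne_zero_iff.2 hu)]

variable [InnerProductSpace ℝ G]

lemma contDiffAt_radialMap {F : E → G} {u : E} (hu : u ≠ 0) (hFu : F u ≠ 0)
    (hF : ContDiffAt ℝ 1 F u) : ContDiffAt ℝ 1 (radialMap F) u :=
  ((hF.norm ℝ hFu).div (contDiffAt_id.norm ℝ hu) (norm_ne_zero_iff.2 hu)).smul contDiffAt_id

lemma norm_sub_one_le_of_close {F : E → G} {A : E →ₗᵢ[ℝ] G} {u : E} (hu : u ≠ 0) {ε : ℝ}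
    (h : ‖F u - A u‖ ≤ ε * ‖u‖) : |‖F u‖ / ‖u‖ - 1| ≤ ε := by
  have hu' : 0 < ‖u‖ := norm_pos_iff.2 hu
  have h1 := (abs_norm_sub_norm_le (F u) (A u)).trans h
  rw [A.norm_map] at h1
  rw [div_sub_one hu'.ne', abs_div, abs_of_pos hu', div_le_iff₀ hu']
  exact h1

lemma ne_zero_of_close {F : E → G} {A : E →ₗᵢ[ℝ] G} {u : E} (hu : u ≠ 0) {ε : ℝ} (hε : ε < 1)
    (h : ‖F u - A u‖ ≤ ε * ‖u‖) : F u ≠ 0 := by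
  intro h0
  have := norm_sub_one_le_of_close hu h
  rw [h0] at this
  norm_num at this
  linarith

/-- If `F` is close to an isometry, the radial map is close to the identity to first order. -/
lemma norm_fderiv_radialMap_sub_id_le {F : E → G} {A : E →ₗᵢ[ℝ] G} {u : E} (hu : u ≠ 0) {ε : ℝ}
    (hε0 : 0 ≤ ε) (hε : ε ≤ 1 / 2) (h : ‖F u - A u‖ ≤ ε * ‖u‖)
    (h' : ‖fderiv ℝ F u - A.toContinuousLinearMap‖ ≤ ε) (hF : DifferentiableAt ℝ F u) :
    ‖fderiv ℝ (radialMap F) u - ContinuousLinearMap.id ℝ E‖ ≤ 13 * ε := by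
  have hu' : 0 < ‖u‖ := norm_pos_iff.2 hu
  have hFu : F u ≠ 0 := ne_zero_of_close hu (by linarith) h
  have hρ1 := norm_sub_one_le_of_close hu h
  set ρ : E → ℝ := fun u => ‖F u‖ / ‖u‖ with hρ
  change |ρ u - 1| ≤ ε at hρ1
  obtain ⟨hρl, hρu⟩ := abs_le.1 hρ1
  have hn : DifferentiableAt ℝ (fun y : E => ‖y‖) u :=
    DifferentiableAt.norm ℝ differentiableAt_id hu
  have hρd : DifferentiableAt ℝ ρ u := by
    simp only [hρ, div_eq_mul_inv]
    exact (hF.norm ℝ hFu).mul (hn.fun_inv (norm_ne_zero_iff.2 hu))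
  have hψ : HasFDerivAt (radialMap F)
      (ρ u • ContinuousLinearMap.id ℝ E + (fderiv ℝ ρ u).smulRight u) u :=
    hρd.hasFDerivAt.smul (hasFDerivAt_id u)
  -- The identity `ρ ^ 2 * ‖·‖ ^ 2 = ‖F ·‖ ^ 2` near `u` is differentiated on both sides; squared
  -- norms keep the formula free of quotients.
  have hrel : ∀ v, ρ u * ‖u‖ ^ 2 * fderiv ℝ ρ u v =
      inner ℝ (F u) (fderiv ℝ F u v) - ρ u ^ 2 * inner ℝ u v := by
    intro v
    have e1 : HasFDerivAt (fun y => ρ y ^ 2 * ‖y‖ ^ 2) _ u :=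
      (hρd.hasFDerivAt.pow 2).mul (hasFDerivAt_id u).norm_sq
    have e2 : HasFDerivAt (fun y => ρ y ^ 2 * ‖y‖ ^ 2) _ u :=
      hF.hasFDerivAt.norm_sq.congr_of_eventuallyEq (by
        filter_upwards [isOpen_ne.mem_nhds hu] with y hy
        have : ‖y‖ ≠ 0 := norm_ne_zero_iff.2 hy
        simp only [hρ]
        field_simp)
    have := congrArg (fun L : E →L[ℝ] ℝ => L v) (e1.unique e2)
    simp at this
    linarith
  rw [hψ.fderiv]
  refine ContinuousLinearMap.opNorm_le_bound _ (by positivity) fun v => ?_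
  -- The three terms of `hsplit` below contribute `2ε`, `ε` and `3ε`. Dividing by `ρ u ≥ 1 / 2`
  -- turns `6` into `12`, and `(ρ u - 1) • v` supplies the last unit of `13`.
  have hb : ‖u‖ * |fderiv ℝ ρ u v| ≤ 12 * ε * ‖v‖ := by
    have hF' : ‖fderiv ℝ F u v‖ ≤ 2 * ‖v‖ := by
      have : fderiv ℝ F u v = (fderiv ℝ F u - A.toContinuousLinearMap) v + A v := by simp
      rw [this]
      refine (norm_add_le _ _).trans ?_
      rw [A.norm_map]
      have := (fderiv ℝ F u - A.toContinuousLinearMap).le_of_opNorm_le h' v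
      nlinarith [norm_nonneg v]
    have hF'' : ‖fderiv ℝ F u v - A v‖ ≤ ε * ‖v‖ :=
      (fderiv ℝ F u - A.toContinuousLinearMap).le_of_opNorm_le h' v
    have hsplit : inner ℝ (F u) (fderiv ℝ F u v) - ρ u ^ 2 * inner ℝ u v =
        inner ℝ (F u - A u) (fderiv ℝ F u v) + inner ℝ (A u) (fderiv ℝ F u v - A v) +
          (1 - ρ u ^ 2) * inner ℝ u v := by
      rw [inner_sub_left, inner_sub_right, A.inner_map_map]
      ring
    have b1 : |inner ℝ (F u - A u) (fderiv ℝ F u v)| ≤ ε * ‖u‖ * (2 * ‖v‖) :=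
      (abs_real_inner_le_norm _ _).trans (by gcongr)
    have b2 : |inner ℝ (A u) (fderiv ℝ F u v - A v)| ≤ ‖u‖ * (ε * ‖v‖) :=
      (abs_real_inner_le_norm _ _).trans (by rw [A.norm_map]; gcongr)
    have b3 : |(1 - ρ u ^ 2) * inner ℝ u v| ≤ 3 * ε * (‖u‖ * ‖v‖) := by
      rw [abs_mul]
      refine mul_le_mul ?_ (abs_real_inner_le_norm _ _) (abs_nonneg _) (by positivity)
      rw [show 1 - ρ u ^ 2 = -((ρ u - 1) * (ρ u + 1)) by ring, abs_neg, abs_mul,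
        abs_of_nonneg (by linarith : 0 ≤ ρ u + 1)]
      nlinarith
    have b : |ρ u * ‖u‖ ^ 2 * fderiv ℝ ρ u v| ≤ 6 * ε * (‖u‖ * ‖v‖) := by
      rw [hrel, hsplit]
      refine (abs_add_three _ _ _).trans ?_
      linarith
    rw [abs_mul, abs_mul, abs_of_pos (by positivity : 0 < ‖u‖ ^ 2),
      abs_of_pos (by linarith : 0 < ρ u)] at b
    have b' : ‖u‖ * (ρ u * (‖u‖ * |fderiv ℝ ρ u v|)) ≤ ‖u‖ * (6 * ε * ‖v‖) := by linarith
    have b'' := le_of_mul_le_mul_left b' hu'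
    have : 0 ≤ ‖u‖ * |fderiv ℝ ρ u v| := by positivity
    nlinarith
  have : (ρ u • ContinuousLinearMap.id ℝ E + (fderiv ℝ ρ u).smulRight u -
      ContinuousLinearMap.id ℝ E) v = (ρ u - 1) • v + (fderiv ℝ ρ u v) • u := by
    simp [sub_smul]
    abel
  rw [this]
  refine (norm_add_le _ _).trans ?_
  rw [norm_smul, norm_smul, Real.norm_eq_abs, Real.norm_eq_abs]
  have := mul_le_mul_of_nonneg_right hρ1 (norm_nonneg v)
  linarith

lemma eventually_close_of_contDiffAt {F : E → G} (hF0 : F 0 = 0) (hF : ContDiffAt ℝ 1 F 0)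
    {A : E →ₗᵢ[ℝ] G} (hA : fderiv ℝ F 0 = A.toContinuousLinearMap) {ε : ℝ} (hε : 0 < ε) :
    ∀ᶠ u in 𝓝 (0 : E), ‖F u - A u‖ ≤ ε * ‖u‖ ∧
      ‖fderiv ℝ F u - A.toContinuousLinearMap‖ ≤ ε ∧ ContDiffAt ℝ 1 F u := by
  have h1 := (hF.differentiableAt one_ne_zero).hasFDerivAt.isLittleO.def hε
  have h2 : ContinuousAt (fderiv ℝ F) 0 := hF.continuousAt_fderiv one_ne_zero
  have h3 := Metric.continuousAt_iff'.1 h2 ε hε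
  filter_upwards [h1, h3, hF.eventually (by simp)] with u hu hu' hu''
  refine ⟨?_, ?_, hu''⟩
  · simpa [hF0, hA] using hu
  · rw [dist_eq_norm, hA] at hu'
    exact hu'.le

lemma hasFDerivAt_radialMap_zero {F : E → G} (hF0 : F 0 = 0) (hF : ContDiffAt ℝ 1 F 0)
    {A : E →ₗᵢ[ℝ] G} (hA : fderiv ℝ F 0 = A.toContinuousLinearMap) :
    HasFDerivAt (radialMap F) (ContinuousLinearMap.id ℝ E) 0 := by
  rw [hasFDerivAt_iff_isLittleO, Asymptotics.isLittleO_iff]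
  intro ε hε
  filter_upwards [eventually_close_of_contDiffAt hF0 hF hA hε] with u hu
  rcases eq_or_ne u 0 with rfl | hu0
  · simp
  · have : radialMap F u - radialMap F 0 - ContinuousLinearMap.id ℝ E (u - 0) =
        (‖F u‖ / ‖u‖ - 1) • u := by
      rw [radialMap_zero, radialMap, sub_smul]
      simp
    rw [this, norm_smul, sub_zero]
    exact mul_le_mul_of_nonneg_right (norm_sub_one_le_of_close hu0 hu.1) (norm_nonneg u)

/-- The norms are singular at the origin, but off the origin the derivative stays within `13 * ε` of
the identity, which is also its value at the origin. -/
lemma continuousAt_fderiv_radialMap_zero {F : E → G} (hF0 : F 0 = 0) (hF : ContDiffAt ℝ 1 F 0)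
    {A : E →ₗᵢ[ℝ] G} (hA : fderiv ℝ F 0 = A.toContinuousLinearMap) :
    ContinuousAt (fderiv ℝ (radialMap F)) 0 := by
  rw [Metric.continuousAt_iff']
  intro ε hε
  -- `13 / 14 < 1` makes the final inequality strict.
  have hη : 0 < min (1 / 2) (ε / 14) := by positivity
  filter_upwards [eventually_close_of_contDiffAt hF0 hF hA hη] with u hu
  rw [(hasFDerivAt_radialMap_zero hF0 hF hA).fderiv, dist_eq_norm]
  rcases eq_or_ne u 0 with rfl | hu0
  · rw [(hasFDerivAt_radialMap_zero hF0 hF hA).fderiv, sub_self, norm_zero]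
    exact hε
  · refine (norm_fderiv_radialMap_sub_id_le hu0 hη.le (min_le_left _ _) hu.1 hu.2.1
      (hu.2.2.differentiableAt one_ne_zero)).trans_lt ?_
    have := min_le_right (1 / 2) (ε / 14)
    linarith

lemma eventually_contDiff_radialMap {F : E → G} (hF0 : F 0 = 0) (hF : ContDiffAt ℝ 1 F 0)
    {A : E →ₗᵢ[ℝ] G} (hA : fderiv ℝ F 0 = A.toContinuousLinearMap) :
    ∀ᶠ u in 𝓝 (0 : E), DifferentiableAt ℝ (radialMap F) u ∧
      ContinuousAt (fderiv ℝ (radialMap F)) u := by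
  filter_upwards [eventually_close_of_contDiffAt hF0 hF hA one_half_pos] with u hu
  rcases eq_or_ne u 0 with rfl | hu0
  · exact ⟨(hasFDerivAt_radialMap_zero hF0 hF hA).differentiableAt,
      continuousAt_fderiv_radialMap_zero hF0 hF hA⟩
  · have := contDiffAt_radialMap hu0 (ne_zero_of_close hu0 (by norm_num) hu.1) hu.2.2
    exact ⟨this.differentiableAt one_ne_zero, this.continuousAt_fderiv one_ne_zero⟩

/-- The inverse function theorem applies to `radialMap F`, whose derivative at the origin is the
identity. Restricting to a small open set keeps the derivative continuous and invertible. -/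
lemma exists_radialCoordinates_of_isometry [FiniteDimensional ℝ E] {F : E → G} (hF0 : F 0 = 0)
    (hF : ContDiffAt ℝ 1 F 0) {A : E →ₗᵢ[ℝ] G} (hA : fderiv ℝ F 0 = A.toContinuousLinearMap) :
    ∃ (e : OpenPartialHomeomorph E E) (e' : E → E →L[ℝ] E), 0 ∈ e.source ∧ e 0 = 0 ∧
      (∀ y ∈ e.source, ‖e y‖ = ‖F y‖ ∧ HasFDerivAt e (e' y) y ∧ (e' y).det ≠ 0) ∧
      ContinuousOn e' e.source := by
  have h0 := hasFDerivAt_radialMap_zero hF0 hF hA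
  have hc0 := continuousAt_fderiv_radialMap_zero hF0 hF hA
  have hev := eventually_contDiff_radialMap hF0 hF hA
  have hstrict : HasStrictFDerivAt (radialMap F)
      ((ContinuousLinearEquiv.refl ℝ E : E ≃L[ℝ] E) : E →L[ℝ] E) 0 := by
    have := hasStrictFDerivAt_of_hasFDerivAt_of_continuousAt
      (hev.mono fun u hu => hu.1.hasFDerivAt) hc0
    rw [h0.fderiv] at this
    exact this
  have hdet : ∀ᶠ u in 𝓝 (0 : E), (fderiv ℝ (radialMap F) u).det ≠ 0 := by
    have : ContinuousAt (fun u => (fderiv ℝ (radialMap F) u).det) 0 :=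
      ContinuousLinearMap.continuous_det.continuousAt.comp hc0
    refine this.eventually_ne ?_
    rw [h0.fderiv]
    simp [ContinuousLinearMap.det]
  obtain ⟨U, hU, hUo, hU0⟩ := eventually_nhds_iff.1 (hev.and hdet)
  set e := (hstrict.toOpenPartialHomeomorph (radialMap F)).restrOpen U hUo with he
  have hsrc : ∀ y ∈ e.source, y ∈ U := fun y hy => by
    rw [he, OpenPartialHomeomorph.restrOpen_source] at hy
    exact hy.2
  have hecoe : (e : E → E) = radialMap F := rfl
  refine ⟨e, fderiv ℝ (radialMap F), ?_, ?_, fun y hy => ⟨?_, ?_, ?_⟩, fun y hy => ?_⟩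
  · rw [he, OpenPartialHomeomorph.restrOpen_source]
    exact ⟨hstrict.mem_toOpenPartialHomeomorph_source, hU0⟩
  · rw [hecoe, radialMap_zero]
  · rw [hecoe, norm_radialMap hF0]
  · rw [hecoe]
    exact (hU y (hsrc y hy)).1.1.hasFDerivAt
  · exact (hU y (hsrc y hy)).2
  · exact (hU y (hsrc y hy)).1.2.continuousWithinAt

/-- The range of `A` has the dimension of `E`, so it is isometric to `E`. Precomposing `A` with
`B⁻¹` gives an isometry, which reduces immersions to the isometric case. -/
lemma exists_continuousLinearEquiv_norm_eq [FiniteDimensional ℝ E] (A : E →L[ℝ] G)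
    (hA : Function.Injective A) : ∃ B : E ≃L[ℝ] E, ∀ v, ‖B v‖ = ‖A v‖ := by
  have hfin : Module.finrank ℝ (LinearMap.range A.toLinearMap) = Module.finrank ℝ E :=
    LinearMap.finrank_range_of_inj hA
  let i : LinearMap.range A.toLinearMap ≃ₗᵢ[ℝ] E :=
    (stdOrthonormalBasis ℝ (LinearMap.range A.toLinearMap)).equiv (stdOrthonormalBasis ℝ E)
      (finCongr hfin)
  let j : E ≃ₗ[ℝ] LinearMap.range A.toLinearMap := LinearEquiv.ofInjective A.toLinearMap hA
  refine ⟨(j.trans i.toLinearEquiv).toContinuousLinearEquiv, fun v => ?_⟩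
  change ‖i (j v)‖ = _
  rw [i.norm_map]
  rfl

/-- Radial normal coordinates: if `F y₀ = 0` and `F` is an immersion at `y₀`, there are `C¹`
coordinates near `y₀` in which `‖F ·‖` is the distance to the origin. -/
lemma exists_radialCoordinates [FiniteDimensional ℝ E] {F : E → G} {y₀ : E} (hF0 : F y₀ = 0)
    (hF : ContDiffAt ℝ 1 F y₀) (hinj : Function.Injective (fderiv ℝ F y₀)) :
    ∃ (e : OpenPartialHomeomorph E E) (e' : E → E →L[ℝ] E), y₀ ∈ e.source ∧ e y₀ = 0 ∧
      (∀ y ∈ e.source, ‖e y‖ = ‖F y‖ ∧ HasFDerivAt e (e' y) y ∧ (e' y).det ≠ 0) ∧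
      ContinuousOn e' e.source := by
  obtain ⟨B, hB⟩ := exists_continuousLinearEquiv_norm_eq (fderiv ℝ F y₀) hinj
  let A : E →ₗᵢ[ℝ] G := ⟨((fderiv ℝ F y₀).comp (B.symm : E →L[ℝ] E)).toLinearMap, fun v => by
    change ‖fderiv ℝ F y₀ (B.symm v)‖ = ‖v‖
    rw [← hB, B.apply_symm_apply]⟩
  let H : E → G := fun u => F (y₀ + B.symm u)
  have hg : HasFDerivAt (fun u => y₀ + B.symm u) (B.symm : E →L[ℝ] E) 0 :=
    B.symm.hasFDerivAt.const_add y₀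
  have hy : y₀ + B.symm 0 = y₀ := by simp
  have hH0 : H 0 = 0 := by simp [H, hF0]
  have hH : ContDiffAt ℝ 1 H 0 := by
    refine ContDiffAt.comp (0 : E) (g := F) (f := fun u => y₀ + B.symm u) (by rwa [hy]) ?_
    exact contDiffAt_const.add B.symm.contDiff.contDiffAt
  have hHA : fderiv ℝ H 0 = A.toContinuousLinearMap := by
    have hF' : HasFDerivAt F (fderiv ℝ F y₀) (y₀ + B.symm 0) := by
      rw [hy]
      exact (hF.differentiableAt one_ne_zero).hasFDerivAt
    exact (hF'.comp (0 : E) hg).fderiv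
  obtain ⟨e, e', h0, he0, he, hec⟩ := exists_radialCoordinates_of_isometry hH0 hH hHA
  let T : E ≃ₜ E := (Homeomorph.subRight y₀).trans B.toHomeomorph
  have hT : ∀ y, T y = B (y - y₀) := fun y => rfl
  have hT0 : T y₀ = 0 := by simp [hT]
  have hTd : ∀ y, HasFDerivAt T (B : E →L[ℝ] E) y := fun y =>
    B.hasFDerivAt.comp y ((hasFDerivAt_id y).sub_const y₀)
  have hsrc : (T.transOpenPartialHomeomorph e).source = T ⁻¹' e.source := rfl
  have hcoe : (T.transOpenPartialHomeomorph e : E → E) = e ∘ T := rfl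
  refine ⟨T.transOpenPartialHomeomorph e, fun y => (e' (T y)).comp (B : E →L[ℝ] E), ?_, ?_,
    fun y hy => ?_, ?_⟩
  · rw [hsrc, Set.mem_preimage, hT0]
    exact h0
  · rw [hcoe, Function.comp_apply, hT0, he0]
  · obtain ⟨h1, h2, h3⟩ := he (T y) hy
    refine ⟨?_, h2.comp y (hTd y), ?_⟩
    · rw [hcoe, Function.comp_apply, h1]
      simp [H, hT]
    · have : ((e' (T y)).comp (B : E →L[ℝ] E)).det = (e' (T y)).det * (B : E →L[ℝ] E).det := by
        simp only [ContinuousLinearMap.det]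
        exact LinearMap.det_comp _ _
      rw [this]
      exact mul_ne_zero h3 (LinearEquiv.isUnit_det' B.toLinearEquiv).ne_zero
  · exact (hec.comp T.continuous.continuousOn fun y hy => hy).clm_comp continuousOn_const

end Radial

/-! ### The volume factor under changes of coordinates -/

section Metric

variable {d D : ℕ}

local notation "E_" => EuclideanSpace ℝ (Fin d)
local notation "G_" => EuclideanSpace ℝ (Fin D)

/-- Expanding `A eᵢ` in the standard basis makes the Gram matrix change by congruence, so `det A`
enters squared and the square root leaves `|det A|`. -/
lemma gram_comp_eq (A : E_ →L[ℝ] E_) (B : E_ →L[ℝ] G_) :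
    (Matrix.gram ℝ fun i : Fin d => B (A (EuclideanSpace.single i 1))) =
      (Matrix.of fun k i => A (EuclideanSpace.single i 1) k).transpose *
        (Matrix.gram ℝ fun i : Fin d => B (EuclideanSpace.single i 1)) *
        (Matrix.of fun k i => A (EuclideanSpace.single i 1) k) := by
  have h : ∀ i, B (A (EuclideanSpace.single i 1)) =
      ∑ k, A (EuclideanSpace.single i 1) k • B (EuclideanSpace.single k 1) := by
    intro i
    conv_lhs => rw [← (EuclideanSpace.basisFun (Fin d) ℝ).sum_repr (A (EuclideanSpace.single i 1))]
    simp
  ext i j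
  rw [Matrix.gram_apply, h i, h j, sum_inner, Matrix.mul_assoc, Matrix.mul_apply]
  refine Finset.sum_congr rfl fun k _ => ?_
  rw [inner_sum, Matrix.mul_apply, Finset.mul_sum]
  refine Finset.sum_congr rfl fun l _ => ?_
  rw [inner_smul_left, inner_smul_right]
  simp [Matrix.gram_apply, mul_comm]

lemma det_of_apply_single (A : E_ →L[ℝ] E_) :
    (Matrix.of fun k i : Fin d => A (EuclideanSpace.single i 1) k).det = A.det := by
  rw [ContinuousLinearMap.det,
    ← LinearMap.det_toMatrix (EuclideanSpace.basisFun (Fin d) ℝ).toBasis]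
  congr 1

/-- The transformation rule of the volume factor under a change of coordinates. -/
lemma sqrtDetMetric_comp {φ : E_ → G_} {T : E_ → E_} {T' : E_ →L[ℝ] E_} {y : E_}
    (hT : HasFDerivAt T T' y) (hφ : DifferentiableAt ℝ φ (T y)) :
    sqrtDetMetric (fun z => φ (T z)) y = |T'.det| * sqrtDetMetric φ (T y) := by
  have h : fderiv ℝ (fun z => φ (T z)) y = (fderiv ℝ φ (T y)).comp T' :=
    (hφ.hasFDerivAt.comp y hT).fderiv
  rw [sqrtDetMetric, h]
  simp only [ContinuousLinearMap.comp_apply]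
  rw [gram_comp_eq, Matrix.det_mul, Matrix.det_mul, Matrix.det_transpose, det_of_apply_single,
    show ∀ a b : ℝ, a * b * a = a ^ 2 * b by intros; ring, Real.sqrt_mul (sq_nonneg _),
    Real.sqrt_sq_eq_abs, sqrtDetMetric]

lemma sqrtDetMetric_congr {φ ψ : E_ → G_} {y : E_} (h : φ =ᶠ[𝓝 y] ψ) :
    sqrtDetMetric φ y = sqrtDetMetric ψ y := by
  rw [sqrtDetMetric, sqrtDetMetric, h.fderiv_eq]

lemma continuousAt_sqrtDetMetric {φ : E_ → G_} {y : E_} (hφ : ContDiffAt ℝ 1 φ y) :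
    ContinuousAt (sqrtDetMetric φ) y := by
  have hc : ContinuousAt (fderiv ℝ φ) y := hφ.continuousAt_fderiv one_ne_zero
  have : Continuous fun L : E_ →L[ℝ] G_ =>
      √(Matrix.gram ℝ fun i : Fin d => L (EuclideanSpace.single i 1)).det := by
    refine Real.continuous_sqrt.comp (Continuous.matrix_det ?_)
    refine continuous_matrix fun i j => ?_
    simp only [Matrix.gram_apply]
    fun_prop
  exact this.continuousAt.comp hc

lemma sqrtDetMetric_nonneg (φ : E_ → G_) (y : E_) : 0 ≤ sqrtDetMetric φ y := Real.sqrt_nonneg _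

lemma sqrtDetMetric_pos {φ : E_ → G_} {y : E_} (h : Function.Injective (fderiv ℝ φ y)) :
    0 < sqrtDetMetric φ y := by
  rw [sqrtDetMetric, Real.sqrt_pos]
  refine (Matrix.posDef_gram_of_linearIndependent ?_).det_pos
  have h1 : LinearIndependent ℝ fun i : Fin d => (EuclideanSpace.single i (1 : ℝ) : E_) := by
    have := (EuclideanSpace.basisFun (Fin d) ℝ).orthonormal.linearIndependent
    rwa [show ⇑(EuclideanSpace.basisFun (Fin d) ℝ) = fun i : Fin d =>
      (EuclideanSpace.single i (1 : ℝ) : E_) from funext fun i => by simp] at this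
  exact h1.map' (fderiv ℝ φ y).toLinearMap (LinearMap.ker_eq_bot.2 h)

end Metric

/-! ### Smooth charts and immersions -/

section Charts

variable {d D : ℕ} {M : Type*} [TopologicalSpace M] [ChartedSpace (EuclideanSpace ℝ (Fin d)) M]
  {ι : M → EuclideanSpace ℝ (Fin D)}

lemma contDiffAt_comp_symm (hι : ContMDiff (𝓡 d) 𝓘(ℝ, EuclideanSpace ℝ (Fin D)) ∞ ι)
    {c : OpenPartialHomeomorph M (EuclideanSpace ℝ (Fin d))}
    (hc : c ∈ IsManifold.maximalAtlas (𝓡 d) ∞ M) {y : EuclideanSpace ℝ (Fin d)}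
    (hy : y ∈ c.target) : ContDiffAt ℝ ∞ (fun z => ι (c.symm z)) y :=
  ((hι (c.symm y)).comp y (contMDiffAt_symm_of_mem_maximalAtlas hc hy)).contDiffAt

lemma contDiffAt_transition
    {c c' : OpenPartialHomeomorph M (EuclideanSpace ℝ (Fin d))}
    (hc : c ∈ IsManifold.maximalAtlas (𝓡 d) ∞ M) (hc' : c' ∈ IsManifold.maximalAtlas (𝓡 d) ∞ M)
    {y : EuclideanSpace ℝ (Fin d)} (hy : y ∈ c.target) (hy' : c.symm y ∈ c'.source) :
    ContDiffAt ℝ ∞ (fun z => c' (c.symm z)) y :=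
  ((contMDiffAt_of_mem_maximalAtlas hc' hy').comp y
    (contMDiffAt_symm_of_mem_maximalAtlas hc hy)).contDiffAt

/-- Around every point there is a chart in which an immersion has an injective derivative. -/
lemma exists_chart_injective_fderiv {x : M}
    (hx : Manifold.IsImmersionAt (𝓡 d) 𝓘(ℝ, EuclideanSpace ℝ (Fin D)) ∞ ι x) :
    ∃ c ∈ IsManifold.maximalAtlas (𝓡 d) ∞ M, x ∈ c.source ∧
      Function.Injective (fderiv ℝ (fun z => ι (c.symm z)) (c x)) := by
  refine ⟨hx.domChart, hx.domChart_mem_maximalAtlas, hx.mem_domChart_source, ?_⟩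
  set c := hx.domChart with hc
  set c' := hx.codChart with hc'
  have hy : c x ∈ c.target := c.map_source hx.mem_domChart_source
  have hcx : c.symm (c x) = x := c.left_inv hx.mem_domChart_source
  have hιd : DifferentiableAt ℝ (fun z => ι (c.symm z)) (c x) := by
    have h1 : ContMDiffAt (𝓡 d) 𝓘(ℝ, EuclideanSpace ℝ (Fin D)) ∞ ι (c.symm (c x)) := by
      rw [hcx]
      exact hx.contMDiffAt
    exact (h1.comp (c x) (contMDiffAt_symm_of_mem_maximalAtlas
      hx.domChart_mem_maximalAtlas hy)).contDiffAt.differentiableAt (by simp)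
  have hcd : DifferentiableAt ℝ c' (ι (c.symm (c x))) := by
    rw [hcx]
    exact (contMDiffAt_of_mem_maximalAtlas hx.codChart_mem_maximalAtlas
      hx.mem_codChart_source).contDiffAt.differentiableAt (by simp)
  -- In the charts of the immersion, `ι` is `z ↦ (z, 0)` up to a linear equivalence. By the chain
  -- rule a vector killed by the derivative of `ι` is killed by this injective map.
  have hev : (fun z => c' (ι (c.symm z))) =ᶠ[𝓝 (c x)] fun z => hx.equiv (z, 0) := by
    filter_upwards [c.open_target.mem_nhds hy] with z hz
    exact hx.writtenInCharts (by simpa using hz)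
  have hd1 : HasFDerivAt (fun z => c' (ι (c.symm z)))
      ((fderiv ℝ c' (ι (c.symm (c x)))).comp (fderiv ℝ (fun z => ι (c.symm z)) (c x))) (c x) :=
    hcd.hasFDerivAt.comp (c x) hιd.hasFDerivAt
  have hd2 : HasFDerivAt (fun z : EuclideanSpace ℝ (Fin d) => hx.equiv (z, (0 : hx.complement)))
      (hx.equiv.toContinuousLinearMap.comp
        (ContinuousLinearMap.inl ℝ (EuclideanSpace ℝ (Fin d)) hx.complement)) (c x) :=
    ContinuousLinearMap.hasFDerivAt (hx.equiv.toContinuousLinearMap.comp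
      (ContinuousLinearMap.inl ℝ (EuclideanSpace ℝ (Fin d)) hx.complement))
  have heq := hd1.unique (hd2.congr_of_eventuallyEq hev)
  refine (injective_iff_map_eq_zero _).2 fun v hv => ?_
  have := congrArg (fun L : EuclideanSpace ℝ (Fin d) →L[ℝ] EuclideanSpace ℝ (Fin D) => L v) heq
  simp only [ContinuousLinearMap.comp_apply, hv, map_zero] at this
  have h0 : hx.equiv (v, 0) = 0 := this.symm
  simpa using h0

lemma chartRiemannianMeasure_le_riemannianMeasure [MeasurableSpace M]
    {c : OpenPartialHomeomorph M (EuclideanSpace ℝ (Fin d))}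
    (hc : c ∈ IsManifold.maximalAtlas (𝓡 d) ∞ M) :
    chartRiemannianMeasure ι c ≤ riemannianMeasure d ι :=
  le_iSup₂_of_le c hc le_rfl

end Charts

/-! ### The Riemannian measure in a chart -/

section RiemannianMeasure

variable {d D : ℕ} {M : Type*} [TopologicalSpace M] [MeasurableSpace M] [BorelSpace M]

lemma measurableSet_target_inter_preimage_symm
    (c : OpenPartialHomeomorph M (EuclideanSpace ℝ (Fin d))) {A : Set M} (hA : MeasurableSet A) :
    MeasurableSet (c.target ∩ c.symm ⁻¹' A) := by
  have h := (continuousOn_iff_continuous_domRestrict.1 c.continuousOn_symm).measurable hA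
  have := (MeasurableEmbedding.subtype_coe c.open_target.measurableSet).measurableSet_image.2 h
  rwa [show Subtype.val '' (c.target.domRestrict c.symm ⁻¹' A) = c.target ∩ c.symm ⁻¹' A by
    ext y
    simp [Set.domRestrict, and_comm]] at this

lemma aemeasurable_symm_restrict_target
    (c : OpenPartialHomeomorph M (EuclideanSpace ℝ (Fin d)))
    (μ : Measure (EuclideanSpace ℝ (Fin d))) : AEMeasurable c.symm (μ.restrict c.target) :=
  c.continuousOn_symm.aemeasurable c.open_target.measurableSet

lemma chartRiemannianMeasure_apply (ι : M → EuclideanSpace ℝ (Fin D))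
    (c : OpenPartialHomeomorph M (EuclideanSpace ℝ (Fin d))) {A : Set M} (hA : MeasurableSet A) :
    chartRiemannianMeasure ι c A = ∫⁻ y in c.target ∩ c.symm ⁻¹' A,
      ENNReal.ofReal (sqrtDetMetric (fun z => ι (c.symm z)) y) := by
  have hae : AEMeasurable c.symm ((volume.restrict c.target).withDensity fun y =>
      ENNReal.ofReal (sqrtDetMetric (fun z => ι (c.symm z)) y)) :=
    (aemeasurable_symm_restrict_target c volume).mono_ac (withDensity_absolutelyContinuous _ _)
  rw [chartRiemannianMeasure, Measure.map_apply_of_aemeasurable hae hA,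
    ← restrict_withDensity c.open_target.measurableSet,
    Measure.restrict_apply' c.open_target.measurableSet, Set.inter_comm,
    withDensity_apply _ (measurableSet_target_inter_preimage_symm c hA)]

lemma chartRiemannianMeasure_apply_inter_source (ι : M → EuclideanSpace ℝ (Fin D))
    (c : OpenPartialHomeomorph M (EuclideanSpace ℝ (Fin d))) {A : Set M} (hA : MeasurableSet A) :
    chartRiemannianMeasure ι c (A ∩ c.source) = chartRiemannianMeasure ι c A := by
  rw [chartRiemannianMeasure_apply ι c hA,
    chartRiemannianMeasure_apply ι c (hA.inter c.open_source.measurableSet)]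
  congr 2
  ext y
  simp only [Set.mem_inter_iff, Set.mem_preimage]
  exact ⟨fun h => ⟨h.1, h.2.1⟩, fun h => ⟨h.1, h.2, c.map_target h.1⟩⟩

variable [ChartedSpace (EuclideanSpace ℝ (Fin d)) M]
  {ι : M → EuclideanSpace ℝ (Fin D)}

/-- The measures coming from two charts agree on the overlap of the charts. -/
lemma chartRiemannianMeasure_eq_of_subset
    (hι : ContMDiff (𝓡 d) 𝓘(ℝ, EuclideanSpace ℝ (Fin D)) ∞ ι)
    {c c' : OpenPartialHomeomorph M (EuclideanSpace ℝ (Fin d))}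
    (hc : c ∈ IsManifold.maximalAtlas (𝓡 d) ∞ M) (hc' : c' ∈ IsManifold.maximalAtlas (𝓡 d) ∞ M)
    {A : Set M} (hA : MeasurableSet A) (hAc : A ⊆ c.source) (hAc' : A ⊆ c'.source) :
    chartRiemannianMeasure ι c' A = chartRiemannianMeasure ι c A := by
  rw [chartRiemannianMeasure_apply ι c hA, chartRiemannianMeasure_apply ι c' hA]
  -- Changing variables by the transition map produces the Jacobian `|det T'|`, exactly the factor
  -- in `sqrtDetMetric_comp`.
  set T : EuclideanSpace ℝ (Fin d) → EuclideanSpace ℝ (Fin d) := fun z => c' (c.symm z) with hT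
  have himg : c'.target ∩ c'.symm ⁻¹' A = T '' (c.target ∩ c.symm ⁻¹' A) := by
    ext z
    constructor
    · rintro ⟨hz, hzA⟩
      refine ⟨c (c'.symm z), ⟨c.map_source (hAc hzA), ?_⟩, ?_⟩
      · rw [Set.mem_preimage, c.left_inv (hAc hzA)]
        exact hzA
      · rw [hT]
        simp only
        rw [c.left_inv (hAc hzA), c'.right_inv hz]
    · rintro ⟨y, ⟨hy, hyA⟩, rfl⟩
      refine ⟨c'.map_source (hAc' hyA), ?_⟩
      rw [Set.mem_preimage, hT]
      simp only
      rw [c'.left_inv (hAc' hyA)]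
      exact hyA
  have hTd : ∀ y ∈ c.target ∩ c.symm ⁻¹' A, HasFDerivAt T (fderiv ℝ T y) y := fun y hy =>
    ((contDiffAt_transition hc hc' hy.1 (hAc' hy.2)).differentiableAt (by simp)).hasFDerivAt
  have hinj : Set.InjOn T (c.target ∩ c.symm ⁻¹' A) := by
    intro y hy z hz h
    exact c.symm.injOn hy.1 hz.1 (c'.injOn (hAc' hy.2) (hAc' hz.2) h)
  rw [himg, lintegral_image_eq_lintegral_abs_det_fderiv_mul volume
    (measurableSet_target_inter_preimage_symm c hA)
    (fun y hy => (hTd y hy).hasFDerivWithinAt) hinj]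
  refine setLIntegral_congr_fun (measurableSet_target_inter_preimage_symm c hA) fun y hy => ?_
  rw [← ENNReal.ofReal_mul (abs_nonneg _), ← sqrtDetMetric_comp (hTd y hy)]
  · congr 1
    refine sqrtDetMetric_congr ?_
    have : c.symm ⁻¹' c'.source ∈ 𝓝 y :=
      (c.continuousAt_symm hy.1).preimage_mem_nhds (c'.open_source.mem_nhds (hAc' hy.2))
    filter_upwards [this] with z hz
    rw [hT]
    simp only
    rw [c'.left_inv hz]
  · exact (contDiffAt_comp_symm hι hc' (c'.map_source (hAc' hy.2))).differentiableAt (by simp)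

/-- On the domain of a chart the Riemannian measure is `√det g(y) dy`. -/
lemma riemannianMeasure_restrict_source
    (hι : ContMDiff (𝓡 d) 𝓘(ℝ, EuclideanSpace ℝ (Fin D)) ∞ ι)
    {c : OpenPartialHomeomorph M (EuclideanSpace ℝ (Fin d))}
    (hc : c ∈ IsManifold.maximalAtlas (𝓡 d) ∞ M) :
    (riemannianMeasure d ι).restrict c.source = chartRiemannianMeasure ι c := by
  have hsrc := c.open_source.measurableSet
  -- The right side dominates every chart measure: on `c.source` by agreement on overlaps, off it
  -- trivially. Hence it dominates the supremum, and its second term vanishes on `c.source`.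
  have hle : riemannianMeasure d ι ≤
      chartRiemannianMeasure ι c + (riemannianMeasure d ι).restrict c.sourceᶜ := by
    refine iSup₂_le fun c' hc' => Measure.le_iff.2 fun A hA => ?_
    rw [Measure.add_apply, Measure.restrict_apply hA, ← Set.sdiff_eq,
      ← measure_inter_add_sdiff A hsrc]
    refine add_le_add ?_ (chartRiemannianMeasure_le_riemannianMeasure hc' _)
    rw [← chartRiemannianMeasure_apply_inter_source ι c' (hA.inter hsrc),
      chartRiemannianMeasure_eq_of_subset hι hc hc'
        ((hA.inter hsrc).inter c'.open_source.measurableSet) (fun z hz => hz.1.2)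
        fun z hz => hz.2]
    exact measure_mono fun z hz => hz.1.1
  ext A hA
  rw [Measure.restrict_apply hA]
  refine le_antisymm ?_ ?_
  · refine (hle _).trans ?_
    rw [Measure.add_apply, Measure.restrict_apply (hA.inter hsrc), Set.inter_assoc,
      Set.inter_compl_self, Set.inter_empty, measure_empty, add_zero]
    exact measure_mono Set.inter_subset_left
  · rw [← chartRiemannianMeasure_apply_inter_source ι c hA]
    exact chartRiemannianMeasure_le_riemannianMeasure hc _

/-- Integration with respect to the Riemannian measure in a chart. -/
lemma setLIntegral_riemannianMeasure
    (hι : ContMDiff (𝓡 d) 𝓘(ℝ, EuclideanSpace ℝ (Fin D)) ∞ ι)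
    {c : OpenPartialHomeomorph M (EuclideanSpace ℝ (Fin d))}
    (hc : c ∈ IsManifold.maximalAtlas (𝓡 d) ∞ M) {A : Set M} (hA : MeasurableSet A)
    (hAc : A ⊆ c.source) {f : M → ENNReal} (hf : AEMeasurable f (riemannianMeasure d ι)) :
    ∫⁻ z in A, f z ∂(riemannianMeasure d ι) = ∫⁻ y in c.target ∩ c.symm ⁻¹' A,
      ENNReal.ofReal (sqrtDetMetric (fun z => ι (c.symm z)) y) * f (c.symm y) := by
  set s : EuclideanSpace ℝ (Fin d) → ENNReal := fun y =>
      ENNReal.ofReal (sqrtDetMetric (fun z => ι (c.symm z)) y) with hs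
  have hsm : AEMeasurable s (volume.restrict c.target) := by
    refine ENNReal.measurable_ofReal.comp_aemeasurable ?_
    refine ContinuousOn.aemeasurable (fun y hy => ?_) c.open_target.measurableSet
    exact (continuousAt_sqrtDetMetric
      ((contDiffAt_comp_symm hι hc hy).of_le (by norm_cast))).continuousWithinAt
  have hae : AEMeasurable c.symm ((volume.restrict c.target).withDensity s) :=
    (aemeasurable_symm_restrict_target c volume).mono_ac (withDensity_absolutelyContinuous _ _)
  have hfc : AEMeasurable f (chartRiemannianMeasure ι c) :=
    hf.mono_measure (chartRiemannianMeasure_le_riemannianMeasure hc)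
  have h1 : ∀ y ∈ c.target, s y * A.indicator f (c.symm y) =
      (c.target ∩ c.symm ⁻¹' A).indicator (fun y => s y * f (c.symm y)) y := by
    intro y hy
    by_cases h : c.symm y ∈ A <;> simp [Set.indicator, h, hy]
  calc ∫⁻ z in A, f z ∂(riemannianMeasure d ι)
      = ∫⁻ z in A, f z ∂(chartRiemannianMeasure ι c) := by
        rw [← riemannianMeasure_restrict_source hι hc, Measure.restrict_restrict hA,
          Set.inter_eq_left.2 hAc]
    _ = ∫⁻ z, A.indicator f z ∂(chartRiemannianMeasure ι c) := (lintegral_indicator hA _).symm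
    _ = ∫⁻ y, A.indicator f (c.symm y) ∂((volume.restrict c.target).withDensity s) :=
        lintegral_map' (hfc.indicator hA) hae
    _ = ∫⁻ y in c.target, s y * A.indicator f (c.symm y) :=
        lintegral_withDensity_eq_lintegral_mul₀' hsm ((hfc.indicator hA).comp_aemeasurable hae)
    _ = ∫⁻ y in c.target ∩ c.symm ⁻¹' A, s y * f (c.symm y) := by
        rw [setLIntegral_congr_fun c.open_target.measurableSet h1,
          setLIntegral_indicator (measurableSet_target_inter_preimage_symm c hA)]
        congr 2
        ext y
        simp +contextual

end RiemannianMeasure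

/-! ### Mass of balls for a density on Euclidean space -/

section BallIntegral

variable {E : Type*} [NormedAddCommGroup E] [InnerProductSpace ℝ E] [FiniteDimensional ℝ E]
  [MeasurableSpace E] [BorelSpace E]

/-- The increments of the mass of balls, for a density with values in `[a, b]`. -/
lemma toReal_setLIntegral_ball_sub_bounds (μ : Measure E) [IsFiniteMeasureOnCompacts μ]
    {w : E → ℝ} {a b R : ℝ} (hb : 0 ≤ b)
    (hw : ∀ z ∈ Metric.ball (0 : E) R, a ≤ w z ∧ w z ≤ b) {r₁ r₂ : ℝ} (h12 : r₁ ≤ r₂)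
    (h2 : r₂ ≤ R) :
    a * (μ.real (Metric.ball 0 r₂) - μ.real (Metric.ball 0 r₁)) ≤
      (∫⁻ z in Metric.ball 0 r₂, ENNReal.ofReal (w z) ∂μ).toReal -
        (∫⁻ z in Metric.ball 0 r₁, ENNReal.ofReal (w z) ∂μ).toReal ∧
    (∫⁻ z in Metric.ball 0 r₂, ENNReal.ofReal (w z) ∂μ).toReal -
        (∫⁻ z in Metric.ball 0 r₁, ENNReal.ofReal (w z) ∂μ).toReal ≤
      b * (μ.real (Metric.ball 0 r₂) - μ.real (Metric.ball 0 r₁)) := by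
  have hsub : Metric.ball (0 : E) r₁ ⊆ Metric.ball 0 r₂ := Metric.ball_subset_ball h12
  have hsm : MeasurableSet (Metric.ball (0 : E) r₂ \ Metric.ball 0 r₁) :=
    measurableSet_ball.diff measurableSet_ball
  set S := Metric.ball (0 : E) r₂ \ Metric.ball 0 r₁ with hS
  have hwS : ∀ z ∈ S, a ≤ w z ∧ w z ≤ b := fun z hz => hw z (Metric.ball_subset_ball h2 hz.1)
  have hfin : ∀ r, μ (Metric.ball (0 : E) r) ≠ ⊤ := fun r =>
    ((measure_mono Metric.ball_subset_closedBall).trans_lt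
      (isCompact_closedBall (0 : E) r).measure_lt_top).ne
  have hSfin : μ S ≠ ⊤ := ne_top_of_le_ne_top (hfin r₂) (measure_mono Set.sdiff_subset)
  have hup : ∀ A : Set E, MeasurableSet A → A ⊆ Metric.ball 0 R →
      ∫⁻ z in A, ENNReal.ofReal (w z) ∂μ ≤ ENNReal.ofReal b * μ A := by
    intro A hA hAR
    rw [← setLIntegral_const]
    exact setLIntegral_mono' hA fun z hz => ENNReal.ofReal_le_ofReal (hw z (hAR hz)).2
  have hLfin : ∀ A : Set E, MeasurableSet A → A ⊆ Metric.ball 0 r₂ →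
      ∫⁻ z in A, ENNReal.ofReal (w z) ∂μ ≠ ⊤ := by
    intro A hA hAR
    refine ne_top_of_le_ne_top ?_ (hup A hA (hAR.trans (Metric.ball_subset_ball h2)))
    exact ENNReal.mul_ne_top ENNReal.ofReal_ne_top
      (ne_top_of_le_ne_top (hfin r₂) (measure_mono hAR))
  have hsplit : (∫⁻ z in Metric.ball 0 r₂, ENNReal.ofReal (w z) ∂μ).toReal -
        (∫⁻ z in Metric.ball 0 r₁, ENNReal.ofReal (w z) ∂μ).toReal =
      (∫⁻ z in S, ENNReal.ofReal (w z) ∂μ).toReal := by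
    rw [← Set.union_sdiff_cancel hsub, lintegral_union hsm Set.disjoint_sdiff_right,
      ENNReal.toReal_add (hLfin _ measurableSet_ball hsub)
      (hLfin _ hsm Set.sdiff_subset)]
    ring
  have hvol : μ.real (Metric.ball 0 r₂) - μ.real (Metric.ball 0 r₁) = μ.real S := by
    rw [hS, measureReal_sdiff hsub measurableSet_ball (hfin r₂)]
  rw [hsplit, hvol]
  constructor
  -- The lower bound `a` may be negative, while `ENNReal.ofReal` truncates at `0`; hence `max a 0`.
  · refine (mul_le_mul_of_nonneg_right (le_max_left a 0) measureReal_nonneg).trans ?_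
    rw [measureReal_def, ← ENNReal.toReal_ofReal', ← ENNReal.toReal_mul]
    refine ENNReal.toReal_mono (hLfin _ hsm Set.sdiff_subset) ?_
    rw [← setLIntegral_const]
    exact setLIntegral_mono' hsm fun z hz => ENNReal.ofReal_le_ofReal (hwS z hz).1
  · have := ENNReal.toReal_mono (ENNReal.mul_ne_top ENNReal.ofReal_ne_top hSfin)
      (hup S hsm (Set.sdiff_subset.trans (Metric.ball_subset_ball h2)))
    rwa [ENNReal.toReal_mul, ENNReal.toReal_ofReal hb] at this

/-- The mass of the ball of log radius `δ`, for a density which is continuous and nonnegative near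
the centre, is a differentiable function of `δ`. -/
lemma differentiableAt_toReal_setLIntegral_ball_exp (μ : Measure E) [μ.IsAddHaarMeasure]
    {w : E → ℝ} {R : ℝ} (hw : ContinuousOn w (Metric.ball 0 R))
    (hw0 : ∀ z ∈ Metric.ball (0 : E) R, 0 ≤ w z) {δ : ℝ} (hδ : Real.exp δ < R) :
    DifferentiableAt ℝ
      (fun t => (∫⁻ z in Metric.ball 0 (Real.exp t), ENNReal.ofReal (w z) ∂μ).toReal) δ := by
  -- In dimension zero there are no polar coordinates, but every ball of positive radius is the
  -- whole space.
  rcases subsingleton_or_nontrivial E with hE | hE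
  · have : ∀ t : ℝ, Metric.ball (0 : E) (Real.exp t) = Set.univ := fun t =>
      Set.eq_univ_of_forall fun z => by simp [Subsingleton.elim z 0, Real.exp_pos]
    simp only [this]
    exact differentiableAt_const _
  · have h1 : DifferentiableAt ℝ (fun t => ∫ z in Metric.ball 0 (Real.exp t), w z ∂μ) δ :=
      (differentiableAt_setIntegral_ball μ hw (Real.exp_pos δ) hδ).comp δ
        Real.differentiableAt_exp
    refine h1.congr_of_eventuallyEq ?_
    filter_upwards [(Real.continuous_exp.tendsto δ).eventually (gt_mem_nhds hδ)] with t ht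
    have hsub : Metric.ball (0 : E) (Real.exp t) ⊆ Metric.ball 0 R :=
      Metric.ball_subset_ball ht.le
    rw [integral_eq_lintegral_of_nonneg_ae]
    · filter_upwards [ae_restrict_mem measurableSet_ball] with z hz
      exact hw0 z (hsub hz)
    · exact (hw.mono hsub).aestronglyMeasurable measurableSet_ball

end BallIntegral

/-! ### Transfer of the law to the model space -/

section Law

variable {d D : ℕ} {M : Set (EuclideanSpace ℝ (Fin D))}
  [ChartedSpace (EuclideanSpace ℝ (Fin d)) M] {p : M → ℝ}

lemma densityLaw_apply {A : Set (EuclideanSpace ℝ (Fin D))} (hA : MeasurableSet A) :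
    densityLaw d M p A = ∫⁻ z in ((↑) : M → EuclideanSpace ℝ (Fin D)) ⁻¹' A, ENNReal.ofReal (p z)
      ∂(riemannianMeasure d ((↑) : M → EuclideanSpace ℝ (Fin D))) := by
  rw [densityLaw, Measure.map_apply measurable_subtype_coe hA,
    withDensity_apply _ (measurable_subtype_coe hA)]

lemma densityLaw_real_apply
    (hp : IsProbabilityDensity (riemannianMeasure d ((↑) : M → EuclideanSpace ℝ (Fin D))) p)
    {A : Set (EuclideanSpace ℝ (Fin D))} (hA : MeasurableSet A) :
    (densityLaw d M p).real A = ∫ z in ((↑) : M → EuclideanSpace ℝ (Fin D)) ⁻¹' A, p z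
      ∂(riemannianMeasure d ((↑) : M → EuclideanSpace ℝ (Fin D))) := by
  rw [measureReal_def, densityLaw_apply hA, integral_eq_lintegral_of_nonneg_ae
    (.of_forall hp.nonneg) hp.integrable.aestronglyMeasurable.restrict]

lemma isProbabilityMeasure_densityLaw
    (hp : IsProbabilityDensity (riemannianMeasure d ((↑) : M → EuclideanSpace ℝ (Fin D))) p) :
    IsProbabilityMeasure (densityLaw d M p) := by
  refine ⟨?_⟩
  rw [densityLaw_apply MeasurableSet.univ, Set.preimage_univ, Measure.restrict_univ,
    ← ofReal_integral_eq_lintegral_ofReal hp.integrable (.of_forall hp.nonneg),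
    hp.integral_eq_one, ENNReal.ofReal_one]

lemma uniformConvolution_eq
    (hp : IsProbabilityDensity (riemannianMeasure d ((↑) : M → EuclideanSpace ℝ (Fin D))) p)
    (x : EuclideanSpace ℝ (Fin D)) (δ : ℝ) :
    uniformConvolution d M p x δ =
      Real.pi ^ (-(D : ℝ) / 2) * Real.Gamma ((D : ℝ) / 2 + 1) * Real.exp (-(D : ℝ) * δ) *
        (densityLaw d M p).real (Metric.ball x (Real.exp δ)) := by
  rw [densityLaw_real_apply hp measurableSet_ball, uniformConvolution,
    ← integral_indicator (measurable_subtype_coe measurableSet_ball), ← integral_const_mul]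
  refine integral_congr_ae (.of_forall fun z => ?_)
  have hmem : x - (z : EuclideanSpace ℝ (Fin D)) ∈ Metric.ball 0 (Real.exp δ) ↔
      (z : EuclideanSpace ℝ (Fin D)) ∈ Metric.ball x (Real.exp δ) := by
    rw [mem_ball_zero_iff, Metric.mem_ball', dist_eq_norm]
  by_cases h : (z : EuclideanSpace ℝ (Fin D)) ∈ Metric.ball x (Real.exp δ)
  · simp only [uniformDensity, Set.indicator_of_mem (hmem.2 h), mul_one]
    rw [Set.indicator_of_mem (Set.mem_preimage.2 h), mul_comm]
  · simp only [uniformDensity, Set.indicator_of_notMem (mt hmem.1 h), mul_zero]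
    rw [Set.indicator_of_notMem (mt Set.mem_preimage.1 h), mul_zero]

/-- Near a point of continuity `x` of `p`, the distance to `x` of a random point of `M` with
density `p` is distributed like the distance to the origin for a density `w` on `ℝᵈ` which is
continuous at the origin. -/
lemma exists_density_on_model [IsManifold (𝓡 d) ∞ M]
    (hM : Manifold.IsSmoothEmbedding (𝓡 d) 𝓘(ℝ, EuclideanSpace ℝ (Fin D)) ∞
      ((↑) : M → EuclideanSpace ℝ (Fin D)))
    (hp : IsProbabilityDensity (riemannianMeasure d ((↑) : M → EuclideanSpace ℝ (Fin D))) p)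
    {x : M} (hcont : ContinuousAt p x) (hpos : 0 < p x) :
    ∃ (w : EuclideanSpace ℝ (Fin d) → ℝ) (R : ℝ), 0 < R ∧ ContinuousAt w 0 ∧ 0 < w 0 ∧
      (∀ r ≤ R, densityLaw d M p (Metric.ball (x : EuclideanSpace ℝ (Fin D)) r) =
        ∫⁻ z in Metric.ball 0 r, ENNReal.ofReal (w z)) ∧
      ((∀ᶠ y in 𝓝 x, ContinuousAt p y) → ∀ᶠ z in 𝓝 0, ContinuousAt w z) := by
  set ι : M → EuclideanSpace ℝ (Fin D) := (↑) with hιdef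
  have hι : ContMDiff (𝓡 d) 𝓘(ℝ, EuclideanSpace ℝ (Fin D)) ∞ ι := hM.contMDiff
  obtain ⟨c, hc, hxc, hinj⟩ := exists_chart_injective_fderiv (hM.isImmersion.isImmersionAt x)
  set φ : EuclideanSpace ℝ (Fin d) → EuclideanSpace ℝ (Fin D) := fun z => ι (c.symm z) with hφ
  have hφd : ∀ y ∈ c.target, ContDiffAt ℝ 1 φ y := fun y hy =>
    (contDiffAt_comp_symm hι hc hy).of_le (by norm_cast)
  have hy₀ : c x ∈ c.target := c.map_source hxc
  have hcx : c.symm (c x) = x := c.left_inv hxc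
  obtain ⟨e₀, e', he₀, he₀0, he₀p, he'c⟩ :=
    exists_radialCoordinates (F := fun y => φ y - ι x) (y₀ := c x) (by simp [hφ, hcx])
      ((hφd _ hy₀).sub contDiffAt_const) (by rwa [fderiv_sub_const])
  set e := e₀.restrOpen c.target c.open_target with he
  have hes : e.source = e₀.source ∩ c.target := OpenPartialHomeomorph.restrOpen_source _ _ _
  have hecoe : ∀ y, e y = e₀ y := fun y => rfl
  have hy₀e : c x ∈ e.source := by rw [hes]; exact ⟨he₀, hy₀⟩
  have he0 : e (c x) = 0 := he₀0
  have hnorm : ∀ y ∈ e.source, ‖e y‖ = ‖φ y - ι x‖ := fun y hy => (he₀p y (hes ▸ hy).1).1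
  have hder : ∀ y ∈ e.source, HasFDerivAt e (e' y) y := fun y hy => (he₀p y (hes ▸ hy).1).2.1
  have hdet : ∀ y ∈ e.source, (e' y).det ≠ 0 := fun y hy => (he₀p y (hes ▸ hy).1).2.2
  have hesc : ∀ y ∈ e.source, y ∈ c.target := fun y hy => (hes ▸ hy).2
  have hdetc : ∀ y ∈ e.source, ContinuousAt (fun y => |(e' y).det|) y := by
    intro y hy
    have : ContinuousAt e' y := he'c.continuousAt (e₀.open_source.mem_nhds (hes ▸ hy).1)
    exact (ContinuousLinearMap.continuous_det.continuousAt.comp this).abs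
  -- The chart density is divided by the Jacobian of `e`, so that `k ∘ e.symm` is the density in
  -- radial coordinates.
  set k : EuclideanSpace ℝ (Fin d) → ℝ := fun y =>
    sqrtDetMetric φ y * p (c.symm y) / |(e' y).det| with hk
  have hkc : ∀ y ∈ e.source, ContinuousAt p (c.symm y) → ContinuousAt k y := by
    intro y hy hpy
    refine ((continuousAt_sqrtDetMetric (hφd y (hesc y hy))).mul ?_).div (hdetc y hy)
      (abs_ne_zero.2 (hdet y hy))
    exact ContinuousAt.comp (f := c.symm) hpy (c.continuousAt_symm (hesc y hy))
  have h0t : (0 : EuclideanSpace ℝ (Fin d)) ∈ e.target := he0 ▸ e.map_source hy₀e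
  have hes0 : e.symm 0 = c x := by rw [← he0, e.left_inv hy₀e]
  have hwc : ∀ z ∈ e.target, ContinuousAt p (c.symm (e.symm z)) →
      ContinuousAt (fun z => k (e.symm z)) z := fun z hz hpz =>
    ContinuousAt.comp (f := e.symm) (hkc _ (e.map_target hz) hpz) (e.continuousAt_symm hz)
  obtain ⟨R₁, hR₁, hball⟩ := Metric.isOpen_iff.1 e.open_target 0 h0t
  -- Since `M` carries the subspace topology, a small ambient ball meets `M` only inside the chart;
  -- no distant part of `M` returns close to `x`.
  obtain ⟨R₂, hR₂, hV⟩ : ∃ R₂ > 0, ∀ m : M, dist m x < R₂ → m ∈ c.source ∧ c m ∈ e.source := by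
    have : ∀ᶠ m in 𝓝 x, m ∈ c.source ∧ c m ∈ e.source :=
      (c.open_source.mem_nhds hxc |> Filter.Eventually.and <|
        (c.continuousAt hxc).preimage_mem_nhds (e.open_source.mem_nhds hy₀e))
    obtain ⟨R₂, hR₂, h⟩ := Metric.eventually_nhds_iff.1 this
    exact ⟨R₂, hR₂, fun m hm => h hm⟩
  refine ⟨fun z => k (e.symm z), min R₁ R₂, lt_min hR₁ hR₂, ?_, ?_, ?_, ?_⟩
  · refine hwc 0 h0t ?_
    rwa [hes0, hcx]
  · simp only [hes0, hk, hcx]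
    exact div_pos (mul_pos (sqrtDetMetric_pos hinj) hpos) (abs_pos.2 (hdet _ hy₀e))
  · intro r hr
    have hAm : MeasurableSet (ι ⁻¹' Metric.ball (ι x) r) :=
      measurable_subtype_coe measurableSet_ball
    have hAV : ∀ m ∈ ι ⁻¹' Metric.ball (ι x) r, m ∈ c.source ∧ c m ∈ e.source := fun m hm =>
      hV m (lt_of_lt_of_le (show dist (ι m) (ι x) < r from hm) (hr.trans (min_le_right _ _)))
    have hSm := measurableSet_target_inter_preimage_symm c hAm
    set S := c.target ∩ c.symm ⁻¹' (ι ⁻¹' Metric.ball (ι x) r) with hS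
    have hSe : ∀ y ∈ S, y ∈ e.source := by
      intro y hy
      have := (hAV _ hy.2).2
      rwa [c.right_inv hy.1] at this
    -- As `‖e y‖` is the ambient distance from `φ y` to `x`, the ball on `M` becomes a round ball
    -- with no error term.
    have himg : Metric.ball 0 r = e '' S := by
      ext z
      constructor
      · intro hz
        have hzt : z ∈ e.target :=
          hball (Metric.ball_subset_ball (hr.trans (min_le_left _ _)) hz)
        have hzs := e.map_target hzt
        refine ⟨e.symm z, ⟨hesc _ hzs, ?_⟩, e.right_inv hzt⟩
        rw [Set.mem_preimage, Set.mem_preimage, mem_ball_iff_norm]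
        change ‖φ (e.symm z) - ι x‖ < r
        rw [← hnorm _ hzs, e.right_inv hzt]
        exact mem_ball_zero_iff.1 hz
      · rintro ⟨y, hy, rfl⟩
        rw [mem_ball_zero_iff, hnorm y (hSe y hy)]
        exact mem_ball_iff_norm.1 hy.2
    rw [densityLaw_apply measurableSet_ball, setLIntegral_riemannianMeasure hι hc hAm
      (fun m hm => (hAV m hm).1) hp.integrable.aestronglyMeasurable.aemeasurable.ennreal_ofReal,
      himg, lintegral_image_eq_lintegral_abs_det_fderiv_mul volume hSm
      (fun y hy => (hder y (hSe y hy)).hasFDerivWithinAt)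
      (e.injOn.mono hSe)]
    refine setLIntegral_congr_fun hSm fun y hy => ?_
    simp only
    rw [e.left_inv (hSe y hy), ← ENNReal.ofReal_mul (abs_nonneg _),
      ← ENNReal.ofReal_mul (sqrtDetMetric_nonneg _ _), hk]
    simp only
    rw [mul_div_cancel₀ _ (abs_ne_zero.2 (hdet y (hSe y hy)))]
  · intro hev
    have h1 : Tendsto (fun z => c.symm (e.symm z)) (𝓝 0) (𝓝 x) := by
      have h2 := e.continuousAt_symm h0t
      have h3 := c.continuousAt_symm hy₀
      rw [ContinuousAt, hes0] at h2
      rw [ContinuousAt, hcx] at h3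
      exact h3.comp h2
    filter_upwards [h1.eventually hev, e.open_target.mem_nhds h0t] with z hz hzt
    exact hwc z hzt hz

end Law

/-! ### Logarithmic derivative of the mass of balls -/

section LogBall

variable {d : ℕ} {X : Type*} [PseudoMetricSpace X] [MeasurableSpace X] {μ : Measure X}
  {x : X} {w : EuclideanSpace ℝ (Fin d) → ℝ} {R : ℝ}

lemma eventually_exp_le_atBot {R : ℝ} (hR : 0 < R) : ∀ᶠ δ : ℝ in atBot, Real.exp δ ≤ R :=
  (Real.tendsto_exp_atBot.eventually (gt_mem_nhds hR)).mono fun _ h => h.le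

lemma volume_real_ball_exp (δ : ℝ) :
    (volume : Measure (EuclideanSpace ℝ (Fin d))).real (Metric.ball 0 (Real.exp δ)) =
      (volume : Measure (EuclideanSpace ℝ (Fin d))).real (Metric.ball 0 1) *
        Real.exp (d * δ) := by
  rw [measureReal_def, Measure.addHaar_ball_of_pos _ _ (Real.exp_pos δ),
    finrank_euclideanSpace_fin, ENNReal.toReal_mul, ENNReal.toReal_ofReal (by positivity),
    ← Real.exp_nat_mul, mul_comm, measureReal_def]

/-- The increments of the mass of balls on both sides of a point where the density is
continuous. -/
lemma exists_ball_increment_bounds (hR : 0 < R) (hwc : ContinuousAt w 0) (hw0 : 0 < w 0)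
    (hμ : ∀ r ≤ R, μ (Metric.ball x r) = ∫⁻ z in Metric.ball 0 r, ENNReal.ofReal (w z))
    {ε : ℝ} (hε : 0 < ε) :
    ∃ R' > 0, ∀ r₁ r₂, r₁ ≤ r₂ → r₂ ≤ R' →
      (w 0 - ε) * (volume.real (Metric.ball (0 : EuclideanSpace ℝ (Fin d)) r₂) -
          volume.real (Metric.ball (0 : EuclideanSpace ℝ (Fin d)) r₁)) ≤
        μ.real (Metric.ball x r₂) - μ.real (Metric.ball x r₁) ∧
      μ.real (Metric.ball x r₂) - μ.real (Metric.ball x r₁) ≤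
        (w 0 + ε) * (volume.real (Metric.ball (0 : EuclideanSpace ℝ (Fin d)) r₂) -
          volume.real (Metric.ball (0 : EuclideanSpace ℝ (Fin d)) r₁)) := by
  obtain ⟨R₁, hR₁, h⟩ := Metric.continuousAt_iff.1 hwc ε hε
  refine ⟨min R R₁, lt_min hR hR₁, fun r₁ r₂ h12 h2 => ?_⟩
  rw [measureReal_def μ, measureReal_def μ, hμ r₂ (h2.trans (min_le_left _ _)),
    hμ r₁ (h12.trans (h2.trans (min_le_left _ _)))]
  refine toReal_setLIntegral_ball_sub_bounds volume (by linarith) (fun z hz => ?_) h12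
    (h2.trans (min_le_right _ _))
  have := abs_lt.1 (h hz)
  constructor <;> linarith [this.1, this.2]

/-- Only small balls are described by `w`, and there the mass is at least `w 0 / 2` times the
volume; a larger ball contains such a ball. -/
lemma measureReal_ball_pos [IsFiniteMeasure μ] (hR : 0 < R) (hwc : ContinuousAt w 0)
    (hw0 : 0 < w 0)
    (hμ : ∀ r ≤ R, μ (Metric.ball x r) = ∫⁻ z in Metric.ball 0 r, ENNReal.ofReal (w z))
    {r : ℝ} (hr : 0 < r) : 0 < μ.real (Metric.ball x r) := by
  obtain ⟨R', hR', h⟩ := exists_ball_increment_bounds hR hwc hw0 hμ (half_pos hw0)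
  have h1 := (h 0 (min r R') (lt_min hr hR').le (min_le_right _ _)).1
  simp only [Metric.ball_zero, measureReal_empty, sub_zero] at h1
  have h2 : 0 < volume.real (Metric.ball (0 : EuclideanSpace ℝ (Fin d)) (min r R')) :=
    ENNReal.toReal_pos (Metric.measure_ball_pos _ _ (lt_min hr hR')).ne' measure_ball_lt_top.ne
  have h3 : 0 < (w 0 - w 0 / 2) * volume.real
      (Metric.ball (0 : EuclideanSpace ℝ (Fin d)) (min r R')) := mul_pos (by linarith) h2
  exact (h3.trans_le h1).trans_le
    (measureReal_mono (Metric.ball_subset_ball (min_le_left _ _)))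

/-- If the mass of small balls is that of balls in `ℝᵈ` for a density which is positive and
continuous at the centre, the logarithmic derivative of the mass tends to `d`. -/
lemma aeDerivTendstoAtBot_log_measureReal_ball [IsFiniteMeasure μ] (hR : 0 < R)
    (hwc : ContinuousAt w 0) (hw0 : 0 < w 0)
    (hμ : ∀ r ≤ R, μ (Metric.ball x r) = ∫⁻ z in Metric.ball 0 r, ENNReal.ofReal (w z)) :
    AeDerivTendstoAtBot (fun δ => Real.log (μ.real (Metric.ball x (Real.exp δ)))) d := by
  set κ := (volume : Measure (EuclideanSpace ℝ (Fin d))).real (Metric.ball 0 1) with hκ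
  have hκ0 : 0 < κ :=
    ENNReal.toReal_pos (Metric.measure_ball_pos _ _ one_pos).ne' measure_ball_lt_top.ne
  -- A shell has volume `κ` times an increment of `exp (d * δ)`, so a tolerance `ε` on `C` is a
  -- tolerance `ε / κ` on `w 0`.
  refine aeDerivTendstoAtBot_log (C := w 0 * κ)
    (fun a b hab => measureReal_mono (Metric.ball_subset_ball (Real.exp_le_exp.2 hab)))
    (fun δ => measureReal_ball_pos hR hwc hw0 hμ (Real.exp_pos δ)) (mul_pos hw0 hκ0)
    (Nat.cast_nonneg d) ?_ ?_
  · intro ε hε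
    obtain ⟨R', hR', h⟩ := exists_ball_increment_bounds hR hwc hw0 hμ (div_pos hε hκ0)
    filter_upwards [eventually_exp_le_atBot hR'] with δ₀ hδ₀ δ₁ δ₂ h12 h2
    have := h (Real.exp δ₁) (Real.exp δ₂) (Real.exp_le_exp.2 h12)
      ((Real.exp_le_exp.2 h2).trans hδ₀)
    simp only [volume_real_ball_exp, ← hκ, ← mul_sub] at this
    have e1 : (w 0 * κ - ε) = (w 0 - ε / κ) * κ := by field_simp
    have e2 : (w 0 * κ + ε) = (w 0 + ε / κ) * κ := by field_simp
    rw [e1, e2, mul_assoc, mul_assoc]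
    exact this
  · intro ε hε
    obtain ⟨R', hR', h⟩ := exists_ball_increment_bounds hR hwc hw0 hμ (div_pos hε hκ0)
    filter_upwards [eventually_exp_le_atBot hR'] with δ₀ hδ₀ δ h2
    -- With inner radius `0` the inner open ball is empty, and the increment bound becomes a bound
    -- on the value.
    have := h 0 (Real.exp δ) (Real.exp_pos δ).le ((Real.exp_le_exp.2 h2).trans hδ₀)
    simp only [volume_real_ball_exp, ← hκ, Metric.ball_zero, measureReal_empty, sub_zero] at this
    have e1 : (w 0 * κ - ε) = (w 0 - ε / κ) * κ := by field_simp
    have e2 : (w 0 * κ + ε) = (w 0 + ε / κ) * κ := by field_simp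
    rw [e1, e2, mul_assoc, mul_assoc]
    exact this

lemma eventually_differentiableAt_log_measureReal_ball [IsFiniteMeasure μ] (hR : 0 < R)
    (hw0 : 0 < w 0) (hwc : ∀ᶠ z in 𝓝 0, ContinuousAt w z)
    (hμ : ∀ r ≤ R, μ (Metric.ball x r) = ∫⁻ z in Metric.ball 0 r, ENNReal.ofReal (w z)) :
    ∀ᶠ δ in atBot, DifferentiableAt ℝ
      (fun δ => Real.log (μ.real (Metric.ball x (Real.exp δ)))) δ := by
  have hpos : ∀ᶠ z in 𝓝 0, 0 < w z := hwc.self_of_nhds.eventually (lt_mem_nhds hw0)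
  obtain ⟨R₁, hR₁, h⟩ := Metric.eventually_nhds_iff_ball.1 (hwc.and hpos)
  filter_upwards [Real.tendsto_exp_atBot.eventually (gt_mem_nhds (lt_min hR hR₁))] with δ hδ
  refine DifferentiableAt.log ?_
    (measureReal_ball_pos hR hwc.self_of_nhds hw0 hμ (Real.exp_pos δ)).ne'
  refine (differentiableAt_toReal_setLIntegral_ball_exp volume
    (fun z hz => (h z hz).1.continuousWithinAt) (fun z hz => (h z hz).2.le)
    (hδ.trans_le (min_le_right _ _))).congr_of_eventuallyEq ?_
  filter_upwards [(Real.continuous_exp.tendsto δ).eventually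
    (gt_mem_nhds (hδ.trans_le (min_le_left _ _)))] with t ht
  rw [measureReal_def, hμ _ (le_of_lt ht)]

end LogBall

/-! ### The limits of the logarithmic derivatives -/

theorem theorem2 {d D : ℕ} (M : Set (EuclideanSpace ℝ (Fin D)))
    [ChartedSpace (EuclideanSpace ℝ (Fin d)) M] [IsManifold (𝓡 d) ∞ M]
    (hM : Manifold.IsSmoothEmbedding (𝓡 d) 𝓘(ℝ, EuclideanSpace ℝ (Fin D)) ∞
      ((↑) : M → EuclideanSpace ℝ (Fin D)))
    (p : M → ℝ)
    (hp : IsProbabilityDensity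
      (riemannianMeasure d ((↑) : M → EuclideanSpace ℝ (Fin D))) p)
    (x : M) (hcont : ContinuousAt p x) (hpos : 0 < p x) :
    -- both logarithms are taken of positive numbers, and the two functions of `δ` are related
    (∀ δ : ℝ, 0 < uniformConvolution d M p x δ ∧
      0 < (densityLaw d M p).real (Metric.ball (x : EuclideanSpace ℝ (Fin D)) (Real.exp δ)) ∧
      uniformConvolution d M p x δ =
        Real.pi ^ (-(D : ℝ) / 2) * Real.Gamma ((D : ℝ) / 2 + 1) * Real.exp (-(D : ℝ) * δ) *
          (densityLaw d M p).real (Metric.ball (x : EuclideanSpace ℝ (Fin D)) (Real.exp δ))) ∧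
    -- the limits of the derivatives
    AeDerivTendstoAtBot (logUniformConvolution d M p x) ((d : ℝ) - D) ∧
    AeDerivTendstoAtBot (logBallProbability d M p x) d ∧
    -- the derivatives exist for all very negative `δ` if `p` is continuous near `x`
    ((∀ᶠ y in 𝓝 x, ContinuousAt p y) →
      DerivTendstoAtBot (logUniformConvolution d M p x) ((d : ℝ) - D) ∧
      DerivTendstoAtBot (logBallProbability d M p x) d) := by
  have := isProbabilityMeasure_densityLaw hp
  obtain ⟨w, R, hR, hwc, hw0, hlaw, hwev⟩ := exists_density_on_model hM hp hcont hpos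
  set K : ℝ := Real.pi ^ (-(D : ℝ) / 2) * Real.Gamma ((D : ℝ) / 2 + 1) with hK
  have hK0 : 0 < K :=
    mul_pos (Real.rpow_pos_of_pos Real.pi_pos _) (Real.Gamma_pos_of_pos (by positivity))
  have hball : ∀ δ : ℝ, 0 < (densityLaw d M p).real
      (Metric.ball (x : EuclideanSpace ℝ (Fin D)) (Real.exp δ)) := fun δ =>
    measureReal_ball_pos hR hwc hw0 hlaw (Real.exp_pos δ)
  have hlog : logUniformConvolution d M p x =
      fun δ => Real.log K + -(D : ℝ) * δ + logBallProbability d M p x δ := by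
    funext δ
    rw [logUniformConvolution, uniformConvolution_eq hp,
      Real.log_mul (mul_pos hK0 (Real.exp_pos _)).ne' (hball δ).ne',
      Real.log_mul hK0.ne' (Real.exp_pos _).ne', Real.log_exp, logBallProbability]
  have hprob : AeDerivTendstoAtBot (logBallProbability d M p x) d :=
    aeDerivTendstoAtBot_log_measureReal_ball hR hwc hw0 hlaw
  have hconv : AeDerivTendstoAtBot (logUniformConvolution d M p x) ((d : ℝ) - D) := by
    rw [hlog, sub_eq_add_neg]
    exact hprob.affine_add _ _
  refine ⟨fun δ => ⟨?_, hball δ, uniformConvolution_eq hp _ δ⟩, hconv, hprob, fun hev => ?_⟩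
  · rw [uniformConvolution_eq hp]
    exact mul_pos (mul_pos hK0 (Real.exp_pos _)) (hball δ)
  · have hdiff : ∀ᶠ δ in atBot, DifferentiableAt ℝ (logBallProbability d M p x) δ :=
      eventually_differentiableAt_log_measureReal_ball hR hw0 (hwev hev) hlaw
    refine ⟨hconv.derivTendstoAtBot ?_, hprob.derivTendstoAtBot hdiff⟩
    filter_upwards [hdiff] with δ hδ
    rw [hlog]
    fun_prop
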